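/- Let $\Delta$ be a negative integer with $\Delta \equiv 0$ or $1 \pmod 4$, and let $\pi \in \{0,1\}$ with $\pi \equiv \Delta \pmod 2$, so that $\Delta \equiv \pi^2 \pmod 4$. Write $[a,b,c]$ for the binary quadratic form $ax^2+bxy+cy^2$ over $\mathbb{Z}$, of discriminant $b^2-4ac$; it is primitive if $\gcd(a,b,c)=1$. Let $\mathrm{GL}_2(\mathbb{Z})$ act on forms by the twisted action $(M\cdot q)(x,y) = \det(M)^{-1}\, q(\alpha x+\beta y, \gamma x+\delta y)$ for $M = \begin{pmatrix}\alpha&\beta\\ \gamma&\delta\end{pmatrix}$, and let $\mathrm{Cl}^{tw}_{\mathbb{Z}}(\Delta)$ be the set of twisted equivalence classes of primitive forms of discriminant $\Delta$. It is an abelian group, with the structure transported through the bijection $$\mathrm{Cl}^{tw}_{\mathbb{Z}}(\Delta) \to \mathrm{Pic}\Big(\mathbb{Z}[\omega]/\big(\omega^2+\pi\omega-\tfrac{\Delta-\pi^2}{4}\big)\Big),\qquad [a,b,c] \mapsto \Big[\big\langle \omega+\tfrac{\pi-b}{2},\, a\big\rangle\Big].$$ For a form $q$ let $\mathrm{Val}_\Delta(q)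 = \{q(x,y) : x,y\in \mathbb{Z}/\Delta\}\cap(\mathbb{Z}/\Delta)^\times$, and for a class $C$ of forms let $H_C = \bigcup_{q\in C}\mathrm{Val}_\Delta(q)$. Let $q_0 = [1,\pi,-\frac{\Delta-\pi^2}{4}]$ be the principal form; $\mathrm{Val}_\Delta(q_0)$ and $\pm\mathrm{Val}_\Delta(q_0)$ are subgroups of $(\mathbb{Z}/\Delta)^\times$. Let $\chi : (\mathbb{Z}/\Delta)^\times \to \{\pm1\}$ be the character with $\chi(p) = \left(\frac{\Delta}{p}\right)$ (Legendre symbol) for all odd primes $p\nmid\Delta$. Then: 1. $\mathrm{Val}_\Delta(q_0) \subseteq \ker\chi$, and the homomorphism $\varphi : \ker(\chi)/\mathrm{Val}_\Delta(q_0) \to (\mathbb{Z}/\Delta)^\times/\pm\mathrm{Val}_\Delta(q_0)$ induced by the inclusion $\ker\chi\subseteq(\mathbb{Z}/\Delta)^\times$ is an isomorphism. 2. For every class $C$ the set $H_C$ is a coset of $\pm\mathrm{Val}_\Delta(q_0)$, the map $\psi : \mathrm{Cl}^{tw}_{\mathbb{Z}}(\Delta) \to (\mathbb{Z}/\Delta)^\times/\pm\mathrm{Val}_\Delta(q_0)$,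 $C\mapsto H_C$, is a group homomorphism, and it induces an isomorphism of abelian groups (the genus map) $$\Psi_{\mathbb{Z}} : \mathrm{Cl}^{tw}_{\mathbb{Z}}(\Delta)/\mathrm{Cl}^{tw}_{\mathbb{Z}}(\Delta)^{\square} \to (\mathbb{Z}/\Delta)^\times/\pm\mathrm{Val}_\Delta(q_0),$$ where $\square$ denotes the subgroup of squares. In particular the principal genus $\ker\psi$ equals the subgroup of squares. -/

import Mathlib

namespace GenusTheory

/-- The binary quadratic form `a x² + b x y + c y²`. -/
@[ext]
structure BinForm (R : Type*) where
  a : R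
  b : R
  c : R

namespace BinForm

variable {R : Type*} [CommRing R]

/-- The value `q(x, y)`. -/
def eval (q : BinForm R) (x y : R) : R := q.a * x ^ 2 + q.b * x * y + q.c * y ^ 2

def disc (q : BinForm R) : R := q.b ^ 2 - 4 * q.a * q.c

/-- The coefficients generate the unit ideal. -/
def IsPrimitive (q : BinForm R) : Prop := Ideal.span {q.a, q.b, q.c} = ⊤

/-- Base change of a form along a ring homomorphism. -/
def map {S : Type*} [CommRing S] (f : R →+* S) (q : BinForm R) : BinForm S :=
  ⟨f q.a, f q.b, f q.c⟩

/-- The twisted action `(M · q)(x, y) = det(M)⁻¹ q(αx + βy, γx + δy)` for `M = (α β; γ δ)`. -/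
def twist (M : GL (Fin 2) R) (q : BinForm R) : BinForm R where
  a := ((Matrix.GeneralLinearGroup.det M)⁻¹ : Rˣ) * q.eval (M 0 0) (M 1 0)
  b := ((Matrix.GeneralLinearGroup.det M)⁻¹ : Rˣ) *
    (2 * q.a * M 0 0 * M 0 1 + q.b * (M 0 0 * M 1 1 + M 0 1 * M 1 0) + 2 * q.c * M 1 0 * M 1 1)
  c := ((Matrix.GeneralLinearGroup.det M)⁻¹ : Rˣ) * q.eval (M 0 1) (M 1 1)

theorem eval_twist (M : GL (Fin 2) R) (q : BinForm R) (x y : R) :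
    (q.twist M).eval x y = ((Matrix.GeneralLinearGroup.det M)⁻¹ : Rˣ) *
      q.eval (M 0 0 * x + M 0 1 * y) (M 1 0 * x + M 1 1 * y) := by
  simp only [twist, eval]
  ring

theorem twist_one (q : BinForm R) : q.twist 1 = q := by
  ext <;> simp [twist, eval]

theorem twist_twist (M N : GL (Fin 2) R) (q : BinForm R) :
    (q.twist M).twist N = q.twist (M * N) := by
  ext <;> simp only [twist, eval, map_mul, mul_inv, Units.val_mul, Matrix.mul_apply,
    Fin.sum_univ_two] <;> ring

end BinForm

/-- Primitive binary quadratic forms over `R` of discriminant `Δ`. -/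
abbrev PrimForm (R : Type*) [CommRing R] (Δ : R) : Type _ :=
  {q : BinForm R // q.IsPrimitive ∧ q.disc = Δ}

/-- Equivalence of primitive forms under the twisted action of `GL₂(R)`. -/
def twSetoid (R : Type*) [CommRing R] (Δ : R) : Setoid (PrimForm R Δ) where
  r q q' := ∃ M : GL (Fin 2) R, q'.1 = q.1.twist M
  iseqv := by
    refine ⟨fun q => ⟨1, q.1.twist_one.symm⟩, ?_, ?_⟩
    · rintro q q' ⟨M, h⟩
      exact ⟨M⁻¹, by rw [h, BinForm.twist_twist, mul_inv_cancel, BinForm.twist_one]⟩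
    · rintro q q' q'' ⟨M, h⟩ ⟨N, h'⟩
      exact ⟨M * N, by rw [h', h, BinForm.twist_twist]⟩

/-- The set of twisted equivalence classes of primitive forms of discriminant `Δ`. -/
def ClTw (R : Type*) [CommRing R] (Δ : R) : Type _ := Quotient (twSetoid R Δ)

namespace ClTw

/-- The class of a form. -/
def mk {R : Type*} [CommRing R] {Δ : R} (q : PrimForm R Δ) : ClTw R Δ :=
  Quotient.mk (twSetoid R Δ) q

end ClTw

/-- `Δ` is a negative integer with `Δ ≡ 0, 1 mod 4`. -/
class NegDisc (Δ : ℤ) : Prop where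
  neg : Δ < 0
  mod_four : Δ ≡ 0 [ZMOD 4] ∨ Δ ≡ 1 [ZMOD 4]

/-- An integer `π` with `Δ ≡ π² mod 4`. -/
def parity (Δ : ℤ) : ℤ := Δ % 2

/-- The principal form `[1, π, -(Δ - π²) / 4]`. -/
def principalForm (Δ : ℤ) : BinForm ℤ := ⟨1, parity Δ, -((Δ - parity Δ ^ 2) / 4)⟩

/-- The quadratic order `ℤ[ω] / (ω² + π ω - (Δ - π²) / 4)` of discriminant `Δ`; its elements
`r + s ω` are written `⟨r, s⟩`. -/
abbrev QuadOrder (Δ : ℤ) : Type := QuadraticAlgebra ℤ ((Δ - parity Δ ^ 2) / 4) (-parity Δ)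

section Order


variable {Δ : ℤ} [hΔ : NegDisc Δ]

theorem four_mul_par : 4 * ((Δ - parity Δ ^ 2) / 4) = Δ - parity Δ ^ 2 := by
  apply Int.mul_ediv_cancel'
  unfold parity
  rcases hΔ.mod_four with h | h
  · have h2 : Δ % 2 = 0 := by unfold Int.ModEq at h; omega
    rw [h2]; unfold Int.ModEq at h; omega
  · have h2 : Δ % 2 = 1 := by unfold Int.ModEq at h; omega
    rw [h2]; unfold Int.ModEq at h; omega

theorem isPrimitive_principalForm : (principalForm Δ).IsPrimitive := by
  rw [BinForm.IsPrimitive, Ideal.eq_top_iff_one]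
  exact Ideal.subset_span (by simp [principalForm])

theorem disc_principalForm : (principalForm Δ).disc = Δ := by
  have := four_mul_par (Δ := Δ)
  simp only [BinForm.disc, principalForm]
  linarith

instance : NoZeroDivisors (QuadOrder Δ) where
  eq_zero_or_eq_zero_of_mul_eq_zero {z w} h := by
    have key : ∀ z : QuadOrder Δ, z.norm = 0 → z = 0 := by
      intro z hz
      rw [QuadraticAlgebra.norm_def] at hz
      have h4 := four_mul_par (Δ := Δ)
      have hneg := hΔ.neg
      have h5 : (2 * z.re - parity Δ * z.im) ^ 2 + (-Δ) * z.im ^ 2 = 0 := by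
        linear_combination 4 * hz + z.im ^ 2 * h4
      have h6 : z.im = 0 := by
        by_contra h0
        have : 0 < z.im ^ 2 := by positivity
        nlinarith [sq_nonneg (2 * z.re - parity Δ * z.im)]
      have h7 : z.re = 0 := by
        rw [h6] at h5
        have : z.re ^ 2 = 0 := by linarith
        exact pow_eq_zero_iff (two_ne_zero) |>.1 this
      exact QuadraticAlgebra.ext h7 h6
    have := congrArg QuadraticAlgebra.norm h
    rw [map_mul, QuadraticAlgebra.norm_zero] at this
    exact (mul_eq_zero.1 this).imp (key z) (key w)

instance : IsDomain (QuadOrder Δ) := NoZeroDivisors.to_isDomain _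

/-- The ideal `⟨ω + (π - b) / 2, a⟩` attached to the form `[a, b, c]`. -/
def formIdeal (q : PrimForm ℤ Δ) : Ideal (QuadOrder Δ) :=
  Ideal.span {QuadraticAlgebra.omega + (((parity Δ - q.1.b) / 2 : ℤ) : QuadOrder Δ),
    ((q.1.a : ℤ) : QuadOrder Δ)}

theorem PrimForm.exists_shift (q : PrimForm ℤ Δ) :
    q.1.b = parity Δ - 2 * ((parity Δ - q.1.b) / 2) := by
  have h4 := four_mul_par (Δ := Δ)
  have hd : q.1.b ^ 2 - 4 * q.1.a * q.1.c = Δ := q.2.2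
  have h : 2 ∣ parity Δ - q.1.b := by
    have : (2 : ℤ) ∣ (parity Δ - q.1.b) ^ 2 :=
      ⟨2 * q.1.a * q.1.c + 2 * ((Δ - parity Δ ^ 2) / 4) + parity Δ ^ 2 - q.1.b * parity Δ, by
        linear_combination hd - h4⟩
    exact Int.prime_two.dvd_of_dvd_pow this
  have := Int.mul_ediv_cancel' h
  linarith

theorem PrimForm.mul_coeff (q : PrimForm ℤ Δ) {k : ℤ} (hk : q.1.b = parity Δ - 2 * k) :
    q.1.a * q.1.c = k ^ 2 - k * parity Δ - (Δ - parity Δ ^ 2) / 4 := by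
  have h4 := four_mul_par (Δ := Δ)
  have hd : q.1.b ^ 2 - 4 * q.1.a * q.1.c = Δ := q.2.2
  rw [hk] at hd
  have : 4 * (q.1.a * q.1.c) = 4 * (k ^ 2 - k * parity Δ - (Δ - parity Δ ^ 2) / 4) := by
    linear_combination -hd + h4
  linarith

theorem PrimForm.a_ne_zero (q : PrimForm ℤ Δ) : q.1.a ≠ 0 := by
  intro h
  have hd : q.1.b ^ 2 - 4 * q.1.a * q.1.c = Δ := q.2.2
  have := hΔ.neg
  rw [h] at hd
  nlinarith [sq_nonneg q.1.b]

theorem formIdeal_eq (q : PrimForm ℤ Δ) {k : ℤ} (hk : q.1.b = parity Δ - 2 * k) :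
    formIdeal q = Ideal.span {(⟨k, 1⟩ : QuadOrder Δ), ⟨q.1.a, 0⟩} := by
  have : (parity Δ - q.1.b) / 2 = k := by omega
  rw [formIdeal, this]
  congr 2
  · ext <;> simp
  
theorem mem_span_pair_iff {a k c : ℤ} (h : a * c = k ^ 2 - k * parity Δ - (Δ - parity Δ ^ 2) / 4)
    (z : QuadOrder Δ) :
    z ∈ Ideal.span {(⟨k, 1⟩ : QuadOrder Δ), ⟨a, 0⟩} ↔ a ∣ z.re - k * z.im := by
  constructor
  · intro hz
    obtain ⟨u, v, rfl⟩ := Ideal.mem_span_pair.1 hz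
    refine ⟨u.im * (-c) + v.re - k * v.im, ?_⟩
    simp only [QuadraticAlgebra.re_add, QuadraticAlgebra.re_mul, QuadraticAlgebra.im_add,
      QuadraticAlgebra.im_mul]
    linear_combination u.im * h
  · rintro ⟨m, hm⟩
    rw [Ideal.mem_span_pair]
    refine ⟨⟨z.im, 0⟩, ⟨m, 0⟩, ?_⟩
    ext
    · simp; linear_combination -hm
    · simp

theorem mem_formIdeal (q : PrimForm ℤ Δ) {k : ℤ} (hk : q.1.b = parity Δ - 2 * k)
    (z : QuadOrder Δ) : z ∈ formIdeal q ↔ q.1.a ∣ z.re - k * z.im := by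
  rw [formIdeal_eq q hk, mem_span_pair_iff (q.mul_coeff hk)]

open nonZeroDivisors

theorem isUnit_formIdeal (q : PrimForm ℤ Δ) :
    IsUnit ((formIdeal q : Ideal (QuadOrder Δ)) :
      FractionalIdeal (QuadOrder Δ)⁰ (FractionRing (QuadOrder Δ))) := by
  obtain ⟨k, hk⟩ : ∃ k, q.1.b = parity Δ - 2 * k := ⟨_, q.exists_shift⟩
  have hac := q.mul_coeff hk
  have hprim : (1 : ℤ) ∈ Ideal.span {q.1.a, q.1.b, q.1.c} := by
    rw [show Ideal.span {q.1.a, q.1.b, q.1.c} = ⊤ from q.2.1]; trivial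
  obtain ⟨r, s, t, hrst⟩ := Submodule.mem_span_triple.1 hprim
  simp only [smul_eq_mul] at hrst
  have hprod : formIdeal q * Ideal.span {(⟨k - parity Δ, -1⟩ : QuadOrder Δ), ⟨q.1.a, 0⟩} =
      Ideal.span {(⟨q.1.a, 0⟩ : QuadOrder Δ)} := by
    rw [formIdeal_eq q hk, Ideal.span_pair_mul_span_pair]
    apply le_antisymm
    · rw [Ideal.span_le]
      rintro z (rfl | rfl | rfl | rfl) <;>
        rw [SetLike.mem_coe, Ideal.mem_span_singleton]
      · refine ⟨⟨q.1.c, 0⟩, ?_⟩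
        ext
        · simp; linear_combination -hac
        · simp; ring
      · exact ⟨⟨k, 1⟩, by ext <;> simp [mul_comm]⟩
      · exact ⟨⟨k - parity Δ, -1⟩, by ext <;> simp⟩
      · exact ⟨⟨q.1.a, 0⟩, rfl⟩
    · rw [Ideal.span_singleton_le_iff_mem]
      have e : (⟨q.1.a, 0⟩ : QuadOrder Δ) =
          ⟨t, 0⟩ * (⟨k, 1⟩ * ⟨k - parity Δ, -1⟩) + (⟨-s, 0⟩ * (⟨k, 1⟩ * ⟨q.1.a, 0⟩) +
          (⟨-s, 0⟩ * (⟨q.1.a, 0⟩ * ⟨k - parity Δ, -1⟩) + ⟨r, 0⟩ * (⟨q.1.a, 0⟩ * ⟨q.1.a, 0⟩))) := by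
        ext
        · simp; linear_combination (-q.1.a) * hrst + t * hac + s * q.1.a * hk
        · simp; right; ring
      have m1 := Ideal.subset_span (s := {(⟨k, 1⟩ * ⟨k - parity Δ, -1⟩ : QuadOrder Δ),
        ⟨k, 1⟩ * ⟨q.1.a, 0⟩, ⟨q.1.a, 0⟩ * ⟨k - parity Δ, -1⟩, ⟨q.1.a, 0⟩ * ⟨q.1.a, 0⟩})
      have hmem := add_mem (Ideal.mul_mem_left _ ⟨t, 0⟩ (m1 (Or.inl rfl)))
        (add_mem (Ideal.mul_mem_left _ ⟨-s, 0⟩ (m1 (Or.inr (Or.inl rfl))))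
        (add_mem (Ideal.mul_mem_left _ ⟨-s, 0⟩ (m1 (Or.inr (Or.inr (Or.inl rfl)))))
        (Ideal.mul_mem_left _ ⟨r, 0⟩ (m1 (Or.inr (Or.inr (Or.inr rfl)))))))
      rwa [← e] at hmem
  have hu : IsUnit ((Ideal.span {(⟨q.1.a, 0⟩ : QuadOrder Δ)} : Ideal (QuadOrder Δ)) :
      FractionalIdeal (QuadOrder Δ)⁰ (FractionRing (QuadOrder Δ))) := by
    rw [FractionalIdeal.coeIdeal_span_singleton]
    have hne : algebraMap (QuadOrder Δ) (FractionRing (QuadOrder Δ)) ⟨q.1.a, 0⟩ ≠ 0 := by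
      rw [Ne, IsFractionRing.to_map_eq_zero_iff]
      intro h
      exact q.a_ne_zero (congrArg QuadraticAlgebra.re h)
    refine IsUnit.of_mul_eq_one (FractionalIdeal.spanSingleton _
      (algebraMap (QuadOrder Δ) (FractionRing (QuadOrder Δ)) ⟨q.1.a, 0⟩)⁻¹) ?_
    rw [FractionalIdeal.spanSingleton_mul_spanSingleton, mul_inv_cancel₀ hne,
      FractionalIdeal.spanSingleton_one]
  rw [← hprod, FractionalIdeal.coeIdeal_mul] at hu
  exact isUnit_of_mul_isUnit_left hu

/-- The class in `Pic` of the ideal attached to a form. -/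
noncomputable def formClass (q : PrimForm ℤ Δ) : ClassGroup (QuadOrder Δ) :=
  ClassGroup.mk (FractionRing (QuadOrder Δ)) (isUnit_formIdeal q).unit

theorem formClass_eq_iff (q q' : PrimForm ℤ Δ) : formClass q = formClass q' ↔
    ∃ x y : QuadOrder Δ, x ≠ 0 ∧ y ≠ 0 ∧
      Ideal.span {x} * formIdeal q = Ideal.span {y} * formIdeal q' :=
  ClassGroup.mk_eq_mk_of_coe_ideal rfl rfl

theorem sq_det_inv (M : GL (Fin 2) ℤ) :
    ∃ d : ℤ, d * d = 1 ∧ M 0 0 * M 1 1 - M 0 1 * M 1 0 = d ∧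
      (((Matrix.GeneralLinearGroup.det M)⁻¹ : ℤˣ) : ℤ) = d := by
  refine ⟨_, ?_, ?_, rfl⟩
  · rw [← Units.val_mul, Int.units_mul_self, Units.val_one]
  · rw [Int.units_inv_eq_self, Matrix.GeneralLinearGroup.val_det_apply, Matrix.det_fin_two]

theorem formClass_eq_of_equiv {q q' : PrimForm ℤ Δ} (h : (twSetoid ℤ Δ) q q') :
    formClass q = formClass q' := by
  obtain ⟨M, hM⟩ := h
  obtain ⟨k, hk⟩ : ∃ k, q.1.b = parity Δ - 2 * k := ⟨_, q.exists_shift⟩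
  obtain ⟨k', hk'⟩ : ∃ k, q'.1.b = parity Δ - 2 * k := ⟨_, q'.exists_shift⟩
  obtain ⟨d, hd1, hd, hd2⟩ := sq_det_inv M
  have ha0 := q.a_ne_zero
  have ha0' := q'.a_ne_zero
  have hac := q.mul_coeff hk
  have ha := congrArg BinForm.a hM
  have hb := congrArg BinForm.b hM
  simp only [BinForm.twist, hd2, BinForm.eval] at ha hb
  have hd0 : d ≠ 0 := by rintro rfl; simp at hd1
  rw [formClass_eq_iff]
  generalize hα : M 0 0 = α at *
  generalize hβ : M 0 1 = β at *
  generalize hγ : M 1 0 = γ at *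
  generalize hδ : M 1 1 = δ at *
  have e1 : (⟨q.1.a * α - (k - parity Δ) * γ, γ⟩ : QuadOrder Δ) * ⟨q.1.a * α - k * γ, -γ⟩ =
      ⟨q.1.a * d, 0⟩ * ⟨q'.1.a, 0⟩ := by
    ext
    · simp only [QuadraticAlgebra.re_mul]
      linear_combination (-q.1.a * d) * ha -
        q.1.a * (q.1.a * α ^ 2 + q.1.b * α * γ + q.1.c * γ ^ 2) * hd1 -
        q.1.a * α * γ * hk - γ ^ 2 * hac
    · simp only [QuadraticAlgebra.im_mul]
      ring
  have e2 : (⟨q.1.a * α - (k - parity Δ) * γ, γ⟩ : QuadOrder Δ) * ⟨q.1.a * β - k * δ, -δ⟩ =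
      ⟨q.1.a * d, 0⟩ * ⟨-k', -1⟩ := by
    ext
    · simp only [QuadraticAlgebra.re_mul]
      apply mul_left_cancel₀ (two_ne_zero (α := ℤ))
      linear_combination (-q.1.a * α * δ - q.1.a * β * γ) * hk - 2 * γ * δ * hac -
        q.1.a * d * hb - q.1.a * (2 * q.1.a * α * β + q.1.b * (α * δ + β * γ) +
        2 * q.1.c * γ * δ) * hd1 - parity Δ * q.1.a * hd + q.1.a * d * hk'
    · simp only [QuadraticAlgebra.im_mul]
      linear_combination (-q.1.a) * hd
  have hy0 : (⟨q.1.a * d, 0⟩ : QuadOrder Δ) ≠ 0 := fun h =>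
    mul_ne_zero ha0 hd0 (congrArg QuadraticAlgebra.re h)
  have ha'0 : (⟨q'.1.a, 0⟩ : QuadOrder Δ) ≠ 0 := fun h => ha0' (congrArg QuadraticAlgebra.re h)
  refine ⟨⟨q.1.a * α - (k - parity Δ) * γ, γ⟩, ⟨q.1.a * d, 0⟩, ?_, hy0, ?_⟩
  · intro h
    rw [h, zero_mul] at e1
    exact mul_ne_zero hy0 ha'0 e1.symm
  apply le_antisymm
  · rw [Ideal.span_singleton_mul_le_span_singleton_mul]
    intro z hz
    obtain ⟨m, hm⟩ := (mem_formIdeal q hk z).1 hz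
    refine ⟨⟨d * (m * δ + z.im * β), 0⟩ * ⟨q'.1.a, 0⟩ - ⟨d * (m * γ + z.im * α), 0⟩ * ⟨-k', -1⟩,
      ?_, ?_⟩
    · rw [mem_formIdeal q' hk']
      exact ⟨d * (m * δ + z.im * β), by simp; ring⟩
    · have hz' : z = ⟨d * (m * δ + z.im * β), 0⟩ * ⟨q.1.a * α - k * γ, -γ⟩ -
          ⟨d * (m * γ + z.im * α), 0⟩ * ⟨q.1.a * β - k * δ, -δ⟩ := by
        ext
        · simp only [QuadraticAlgebra.re_mul, QuadraticAlgebra.re_sub]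
          linear_combination hm - (q.1.a * m + k * z.im) * hd1 - d * (q.1.a * m + k * z.im) * hd
        · simp only [QuadraticAlgebra.im_mul, QuadraticAlgebra.im_sub]
          linear_combination - z.im * hd1 - d * z.im * hd
      linear_combination (⟨q.1.a * α - (k - parity Δ) * γ, γ⟩ : QuadOrder Δ) * hz' +
        (⟨d * (m * δ + z.im * β), 0⟩ : QuadOrder Δ) * e1 -
        (⟨d * (m * γ + z.im * α), 0⟩ : QuadOrder Δ) * e2
  · rw [Ideal.span_singleton_mul_le_span_singleton_mul]
    intro z hz
    obtain ⟨m, hm⟩ := (mem_formIdeal q' hk' z).1 hz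
    refine ⟨⟨m, 0⟩ * ⟨q.1.a * α - k * γ, -γ⟩ - ⟨z.im, 0⟩ * ⟨q.1.a * β - k * δ, -δ⟩, ?_, ?_⟩
    · rw [mem_formIdeal q hk]
      exact ⟨m * α - z.im * β, by simp; ring⟩
    · have hz' : z = ⟨m, 0⟩ * ⟨q'.1.a, 0⟩ - ⟨z.im, 0⟩ * ⟨-k', -1⟩ := by
        ext
        · simp only [QuadraticAlgebra.re_mul, QuadraticAlgebra.re_sub]
          linear_combination hm
        · simp only [QuadraticAlgebra.im_mul, QuadraticAlgebra.im_sub]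
          ring
      linear_combination (⟨q.1.a * d, 0⟩ : QuadOrder Δ) * hz' - (⟨m, 0⟩ : QuadOrder Δ) * e1 +
        (⟨z.im, 0⟩ : QuadOrder Δ) * e2

theorem equiv_of_formClass_eq {q q' : PrimForm ℤ Δ} (h : formClass q = formClass q') :
    (twSetoid ℤ Δ) q q' := by
  obtain ⟨k, hk⟩ : ∃ k, q.1.b = parity Δ - 2 * k := ⟨_, q.exists_shift⟩
  obtain ⟨k', hk'⟩ : ∃ k, q'.1.b = parity Δ - 2 * k := ⟨_, q'.exists_shift⟩
  have hac := q.mul_coeff hk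
  have hac' := q'.mul_coeff hk'
  have ha0 := q.a_ne_zero
  have ha0' := q'.a_ne_zero
  obtain ⟨x, y, hx, hy, hxy⟩ := (formClass_eq_iff q q').1 h
  have key : ∀ (q q' : PrimForm ℤ Δ) (k : ℤ) (_ : q.1.b = parity Δ - 2 * k) (x y : QuadOrder Δ)
      (_ : Ideal.span {x} * formIdeal q = Ideal.span {y} * formIdeal q') (w : QuadOrder Δ)
      (_ : w ∈ formIdeal q'), ∃ m n : ℤ, y * w = x * ⟨q.1.a * m - k * n, -n⟩ := by
    intro q q' k hk x y hxy w hw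
    obtain ⟨z, hz, h⟩ := Ideal.span_singleton_mul_le_span_singleton_mul.1 hxy.ge w hw
    obtain ⟨m, hm⟩ := (mem_formIdeal q hk z).1 hz
    refine ⟨m, -z.im, ?_⟩
    rw [h]
    congr 1
    ext
    · simp only; linear_combination hm
    · simp
  obtain ⟨α, γ, h1⟩ := key q q' k hk x y hxy ⟨q'.1.a, 0⟩ (by simp [mem_formIdeal q' hk'])
  obtain ⟨β, δ, h2⟩ := key q q' k hk x y hxy ⟨-k', -1⟩ (by simp [mem_formIdeal q' hk'])
  obtain ⟨α', γ', h3⟩ := key q' q k' hk' y x hxy.symm ⟨q.1.a, 0⟩ (by simp [mem_formIdeal q hk])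
  obtain ⟨β', δ', h4⟩ := key q' q k' hk' y x hxy.symm ⟨-k, -1⟩ (by simp [mem_formIdeal q hk])
  have h5 : (⟨q.1.a, 0⟩ : QuadOrder Δ) =
      ⟨α', 0⟩ * ⟨q.1.a * α - k * γ, -γ⟩ + ⟨γ', 0⟩ * ⟨q.1.a * β - k * δ, -δ⟩ := by
    apply mul_left_cancel₀ hx
    rw [h3, mul_add, mul_left_comm, ← h1, mul_left_comm x, ← h2, mul_left_comm, mul_left_comm _ y,
      ← mul_add]
    congr 1
    ext
    · simp only [QuadraticAlgebra.re_mul, QuadraticAlgebra.re_add]; ring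
    · simp only [QuadraticAlgebra.im_mul, QuadraticAlgebra.im_add]; ring
  have h6 : (⟨-k, -1⟩ : QuadOrder Δ) =
      ⟨β', 0⟩ * ⟨q.1.a * α - k * γ, -γ⟩ + ⟨δ', 0⟩ * ⟨q.1.a * β - k * δ, -δ⟩ := by
    apply mul_left_cancel₀ hx
    rw [h4, mul_add, mul_left_comm, ← h1, mul_left_comm x, ← h2, mul_left_comm, mul_left_comm _ y,
      ← mul_add]
    congr 1
    ext
    · simp only [QuadraticAlgebra.re_mul, QuadraticAlgebra.re_add]; ring
    · simp only [QuadraticAlgebra.im_mul, QuadraticAlgebra.im_add]; ring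
  have h5i := congrArg QuadraticAlgebra.im h5
  have h5r := congrArg QuadraticAlgebra.re h5
  have h6i := congrArg QuadraticAlgebra.im h6
  have h6r := congrArg QuadraticAlgebra.re h6
  simp only [QuadraticAlgebra.re_mul, QuadraticAlgebra.re_add, QuadraticAlgebra.im_mul,
    QuadraticAlgebra.im_add] at h5i h5r h6i h6r
  have g1 : α' * γ + γ' * δ = 0 := by linarith
  have g2 : α' * α + γ' * β = 1 := by
    apply mul_left_cancel₀ ha0
    linear_combination -h5r + k * g1
  have g3 : β' * γ + δ' * δ = 1 := by linarith
  have g4 : β' * α + δ' * β = 0 := by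
    apply mul_left_cancel₀ ha0
    linear_combination -h6r + k * g3
  have hdet : (α * δ - β * γ) * (α' * δ' - γ' * β') = 1 := by
    linear_combination g2 * (β' * γ + δ' * δ) + g3 - g4 * (α' * γ + γ' * δ)
  have hcross : (⟨q'.1.a, 0⟩ : QuadOrder Δ) * ⟨q.1.a * β - k * δ, -δ⟩ =
      ⟨q.1.a * α - k * γ, -γ⟩ * ⟨-k', -1⟩ := by
    apply mul_left_cancel₀ (mul_ne_zero hx hy)
    linear_combination (x * ⟨q.1.a * β - k * δ, -δ⟩) * h1 - (x * ⟨q.1.a * α - k * γ, -γ⟩) * h2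
  have hcross2 := congrArg (fun w => (⟨q.1.a * α - (k - parity Δ) * γ, γ⟩ : QuadOrder Δ) * w) hcross
  have hr := congrArg QuadraticAlgebra.re hcross2
  have hi := congrArg QuadraticAlgebra.im hcross2
  simp only [QuadraticAlgebra.re_mul, QuadraticAlgebra.im_mul] at hr hi
  obtain ⟨d, hd⟩ : ∃ d, d = α * δ - β * γ := ⟨_, rfl⟩
  have hdu : IsUnit d := by rw [hd]; exact IsUnit.of_mul_eq_one _ hdet
  have hdd : d * d = 1 := by
    rcases Int.isUnit_iff.1 hdu with h | h <;> rw [h] <;> norm_num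
  have hQ : q.1.a * α ^ 2 + q.1.b * α * γ + q.1.c * γ ^ 2 = d * q'.1.a := by
    apply mul_left_cancel₀ ha0
    linear_combination hi + q.1.a * α * γ * hk + γ ^ 2 * hac - q.1.a * q'.1.a * hd
  have hB : q'.1.b = d * (2 * q.1.a * α * β + q.1.b * (α * δ + β * γ) + 2 * q.1.c * γ * δ) := by
    have hP : (2 * q.1.a * α * β + q.1.b * (α * δ + β * γ) + 2 * q.1.c * γ * δ) =
        d * q'.1.b := by
      apply mul_left_cancel₀ (mul_ne_zero ha0 ha0')
      linear_combination 2 * hr - 2 * k' * (q.1.a * hQ - q.1.a * α * γ * hk - γ ^ 2 * hac) -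
        q.1.a * q'.1.a * parity Δ * hd + q'.1.a * (q.1.a * α * δ + q.1.a * β * γ) * hk +
        2 * q'.1.a * γ * δ * hac - q.1.a * q'.1.a * d * hk'
    rw [hP]; linear_combination (-q'.1.b) * hdd
  have hA : q'.1.a = d * (q.1.a * α ^ 2 + q.1.b * α * γ + q.1.c * γ ^ 2) := by
    rw [hQ]; linear_combination (-q'.1.a) * hdd
  have hC : q'.1.c = d * (q.1.a * β ^ 2 + q.1.b * β * δ + q.1.c * δ ^ 2) := by
    have hD : q.1.b ^ 2 - 4 * q.1.a * q.1.c = Δ := q.2.2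
    have hD' : q'.1.b ^ 2 - 4 * q'.1.a * q'.1.c = Δ := q'.2.2
    apply mul_left_cancel₀ (mul_ne_zero (four_ne_zero (α := ℤ)) ha0')
    linear_combination -hD' + (q'.1.b + d * (2 * q.1.a * α * β + q.1.b * (α * δ + β * γ) + 2 * q.1.c * γ * δ)) * hB +
      (2 * q.1.a * α * β + q.1.b * (α * δ + β * γ) + 2 * q.1.c * γ * δ) ^ 2 * hdd +
      4 * (q.1.a * β ^ 2 + q.1.b * β * δ + q.1.c * δ ^ 2) * hQ +
      (α * δ - β * γ) ^ 2 * hD + Δ * (hdd - (d + α * δ - β * γ) * hd)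
  have hM : IsUnit (Matrix.det !![α, β; γ, δ]) := by
    rw [Matrix.det_fin_two_of, ← hd]; exact hdu
  refine ⟨Matrix.GeneralLinearGroup.mk'' !![α, β; γ, δ] hM, ?_⟩
  obtain ⟨e, -, he, he2⟩ := sq_det_inv (Matrix.GeneralLinearGroup.mk'' !![α, β; γ, δ] hM)
  have hed : e = d := by rw [← he, hd]; rfl
  rw [hed] at he2
  ext
  · simp only [BinForm.twist, he2]
    exact hA
  · simp only [BinForm.twist, he2]
    exact hB
  · simp only [BinForm.twist, he2]
    exact hC

theorem exists_formIdeal (N : Ideal (QuadOrder Δ)) (hN : IsUnit (N :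
      FractionalIdeal (QuadOrder Δ)⁰ (FractionRing (QuadOrder Δ)))) :
    ∃ (x : QuadOrder Δ) (q : PrimForm ℤ Δ), x ≠ 0 ∧ N = Ideal.span {x} * formIdeal q := by
  have hN0 : N ≠ ⊥ := by
    rintro rfl
    simp at hN
  -- a basis of `N` over `ℤ` in normal form
  obtain ⟨A, hA⟩ : ∃ A : ℤ, ∀ n : ℤ, (⟨n, 0⟩ : QuadOrder Δ) ∈ N ↔ A ∣ n := by
    let T : Ideal ℤ := N.comap (algebraMap ℤ (QuadOrder Δ))
    refine ⟨Submodule.IsPrincipal.generator T, fun n => ?_⟩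
    rw [← Submodule.IsPrincipal.mem_iff_generator_dvd T, Ideal.mem_comap]
    rfl
  obtain ⟨g, hg⟩ : ∃ g : ℤ, ∀ n : ℤ, (∃ z ∈ N, z.im = n) ↔ g ∣ n := by
    let S : Ideal ℤ :=
      { carrier := {n | ∃ z ∈ N, z.im = n}
        add_mem' := by
          rintro _ _ ⟨z, hz, rfl⟩ ⟨w, hw, rfl⟩
          exact ⟨z + w, N.add_mem hz hw, rfl⟩
        zero_mem' := ⟨0, N.zero_mem, rfl⟩
        smul_mem' := by
          rintro c _ ⟨z, hz, rfl⟩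
          exact ⟨⟨c, 0⟩ * z, N.mul_mem_left _ hz, by simp⟩ }
    refine ⟨Submodule.IsPrincipal.generator S, fun n => ?_⟩
    rw [← Submodule.IsPrincipal.mem_iff_generator_dvd S]
    rfl
  obtain ⟨z0, hz0, hz0g⟩ := (hg g).2 dvd_rfl
  have hA0 : A ≠ 0 := by
    obtain ⟨z, hz, hzne⟩ := Submodule.exists_mem_ne_zero_of_ne_bot hN0
    rintro rfl
    have h1 : (⟨z.norm, 0⟩ : QuadOrder Δ) ∈ N := by
      have := QuadraticAlgebra.algebraMap_norm_eq_mul_star z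
      have h2 : (⟨z.norm, 0⟩ : QuadOrder Δ) = z * star z := by rw [← this]; rfl
      rw [h2]
      exact N.mul_mem_right _ hz
    have h2 := zero_dvd_iff.1 ((hA _).1 h1)
    have h3 : z * star z = 0 := by
      rw [← QuadraticAlgebra.algebraMap_norm_eq_mul_star, h2, map_zero]
    rcases mul_eq_zero.1 h3 with h | h
    · exact hzne h
    · exact hzne (by rw [← star_star z, h, star_zero])
  obtain ⟨a, ha⟩ : g ∣ A := (hg A).1
    ⟨⟨0, 1⟩ * ⟨A, 0⟩, N.mul_mem_left _ ((hA A).2 dvd_rfl), by simp⟩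
  have hg0 : g ≠ 0 := by rintro rfl; simp at ha; exact hA0 ha
  have ha0 : a ≠ 0 := by rintro rfl; simp at ha; exact hA0 ha
  obtain ⟨k, hk⟩ : g ∣ z0.re := by
    have h1 : g ∣ z0.re + (-parity Δ) * z0.im := (hg _).1
      ⟨⟨0, 1⟩ * z0, N.mul_mem_left _ hz0, by simp⟩
    rw [hz0g] at h1
    exact (Int.dvd_add_left (Dvd.intro_left _ rfl)).1 h1
  have hmem : ∀ z, z ∈ N ↔ ∃ w : QuadOrder Δ, z = ⟨g, 0⟩ * w ∧ a ∣ w.re - k * w.im := by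
    intro z
    constructor
    · intro hz
      obtain ⟨n, hn⟩ := (hg z.im).1 ⟨z, hz, rfl⟩
      have h1 : (⟨z.re - n * z0.re, 0⟩ : QuadOrder Δ) ∈ N := by
        have : (⟨z.re - n * z0.re, 0⟩ : QuadOrder Δ) = z - ⟨n, 0⟩ * z0 := by
          ext
          · simp
          · simp [hn, hz0g, mul_comm]
        rw [this]
        exact N.sub_mem hz (N.mul_mem_left _ hz0)
      obtain ⟨m, hm⟩ := (hA _).1 h1
      refine ⟨⟨a * m + k * n, n⟩, ?_, ⟨m, by simp only; ring⟩⟩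
      ext
      · simp; rw [hk, ha] at hm; linear_combination hm
      · simp [hn]
    · rintro ⟨w, rfl, m, hm⟩
      have : (⟨g, 0⟩ * w : QuadOrder Δ) = ⟨m, 0⟩ * ⟨A, 0⟩ + ⟨w.im, 0⟩ * z0 := by
        ext
        · simp; rw [hk, ha]; linear_combination g * hm
        · simp [hz0g, mul_comm]
      rw [this]
      exact N.add_mem (N.mul_mem_left _ ((hA A).2 dvd_rfl)) (N.mul_mem_left _ hz0)
  obtain ⟨c, hc⟩ : a ∣ k ^ 2 - k * parity Δ - (Δ - parity Δ ^ 2) / 4 := by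
    have h1 : (⟨g, 0⟩ * ⟨k, 1⟩ : QuadOrder Δ) ∈ N := (hmem _).2 ⟨_, rfl, by simp⟩
    have h2 := N.mul_mem_left ⟨k - parity Δ, -1⟩ h1
    obtain ⟨w, hw, hd⟩ := (hmem _).1 h2
    have hw' : (⟨k - parity Δ, -1⟩ * ⟨k, 1⟩ : QuadOrder Δ) = w := by
      apply mul_left_cancel₀ (a := (⟨g, 0⟩ : QuadOrder Δ))
      · intro h; exact hg0 (congrArg QuadraticAlgebra.re h)
      · rw [← hw, mul_left_comm]
    rw [← hw'] at hd
    convert hd using 1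
    simp
    ring
  have hspan : N = Ideal.span {(⟨g, 0⟩ : QuadOrder Δ)} *
      Ideal.span {(⟨k, 1⟩ : QuadOrder Δ), ⟨a, 0⟩} := by
    ext z
    rw [Ideal.mem_span_singleton_mul, hmem]
    constructor
    · rintro ⟨w, hw, hd⟩
      exact ⟨w, (mem_span_pair_iff hc.symm w).2 hd, hw.symm⟩
    · rintro ⟨w, hw, hd⟩
      exact ⟨w, hd.symm, (mem_span_pair_iff hc.symm w).1 hw⟩
  -- invertibility forces primitivity
  have hunit := hN
  rw [hspan, FractionalIdeal.coeIdeal_mul] at hunit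
  have hIu := isUnit_of_mul_isUnit_right hunit
  obtain ⟨J, t, ht, hJ⟩ : ∃ (J : Ideal (QuadOrder Δ)) (t : QuadOrder Δ), t ≠ 0 ∧
      Ideal.span {(⟨k, 1⟩ : QuadOrder Δ), ⟨a, 0⟩} * J = Ideal.span {t} := by
    obtain ⟨u, hu⟩ := hIu
    obtain ⟨t, J, ht, hJ⟩ := FractionalIdeal.exists_eq_spanSingleton_mul
      ((u⁻¹ : (FractionalIdeal (QuadOrder Δ)⁰ (FractionRing (QuadOrder Δ)))ˣ) :
        FractionalIdeal (QuadOrder Δ)⁰ (FractionRing (QuadOrder Δ)))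
    have ht' : algebraMap (QuadOrder Δ) (FractionRing (QuadOrder Δ)) t ≠ 0 := by
      rwa [Ne, IsFractionRing.to_map_eq_zero_iff]
    refine ⟨J, t, ht, ?_⟩
    apply FractionalIdeal.coeIdeal_injective (K := FractionRing (QuadOrder Δ))
    have h1 := u.mul_inv
    beta_reduce
    rw [hJ, hu, mul_left_comm] at h1
    rw [FractionalIdeal.coeIdeal_mul, FractionalIdeal.coeIdeal_span_singleton]
    have h2 := congrArg (fun X => FractionalIdeal.spanSingleton (QuadOrder Δ)⁰
      (algebraMap (QuadOrder Δ) (FractionRing (QuadOrder Δ)) t) * X) h1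
    simp only [mul_one] at h2
    rw [← h2, ← mul_assoc, FractionalIdeal.spanSingleton_mul_spanSingleton, mul_inv_cancel₀ ht',
      FractionalIdeal.spanSingleton_one, one_mul]
  have hprim : (⟨a, parity Δ - 2 * k, c⟩ : BinForm ℤ).IsPrimitive := by
    let D : Ideal ℤ := Ideal.span {a, parity Δ - 2 * k, c}
    obtain ⟨d, hd⟩ : ∃ d, D = Ideal.span {d} :=
      ⟨_, (Ideal.span_singleton_generator D).symm⟩
    have hdvd : ∀ x ∈ D, d ∣ x := fun x hx => by
      rwa [hd, Ideal.mem_span_singleton] at hx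
    obtain ⟨a', ha'⟩ := hdvd a (Ideal.subset_span (by simp))
    obtain ⟨b', hb'⟩ := hdvd (parity Δ - 2 * k) (Ideal.subset_span (by simp))
    obtain ⟨c', hc'⟩ := hdvd c (Ideal.subset_span (by simp))
    have hle : Ideal.span {(⟨k, 1⟩ : QuadOrder Δ)} *
        Ideal.span {(⟨k, 1⟩ : QuadOrder Δ), ⟨a, 0⟩} ≤
        Ideal.span {(⟨d, 0⟩ : QuadOrder Δ)} * Ideal.span {(⟨k, 1⟩ : QuadOrder Δ), ⟨a, 0⟩} := by
      rw [Ideal.span_singleton_mul_le_span_singleton_mul]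
      intro z hz
      obtain ⟨m, hm⟩ := (mem_span_pair_iff hc.symm z).1 hz
      refine ⟨⟨k * (a' * m - b' * z.im) - a * c' * z.im, a' * m - b' * z.im⟩, ?_, ?_⟩
      · rw [mem_span_pair_iff hc.symm]
        exact ⟨-c' * z.im, by simp; ring⟩
      · ext
        · simp only [QuadraticAlgebra.re_mul]
          linear_combination k * hm + k * m * ha' - k * z.im * hb' - a * z.im * hc' - z.im * hc
        · simp only [QuadraticAlgebra.im_mul]
          linear_combination hm + m * ha' - z.im * hb'
    have hle2 := Ideal.mul_mono_left (K := J) hle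
    rw [mul_assoc, mul_assoc, hJ, Ideal.span_singleton_mul_span_singleton,
      Ideal.span_singleton_mul_span_singleton, Ideal.span_singleton_le_span_singleton] at hle2
    obtain ⟨s, hs⟩ := hle2
    have hs' : (⟨k, 1⟩ : QuadOrder Δ) = ⟨d, 0⟩ * s := by
      apply mul_right_cancel₀ ht
      rw [hs]; ring
    have := congrArg QuadraticAlgebra.im hs'
    simp at this
    have hD : D = ⊤ := by
      rw [hd, Ideal.span_singleton_eq_top]
      exact IsUnit.of_mul_eq_one _ this.symm
    exact hD
  have hdisc : (⟨a, parity Δ - 2 * k, c⟩ : BinForm ℤ).disc = Δ := by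
    have h4 := four_mul_par (Δ := Δ)
    simp only [BinForm.disc]
    linear_combination 4 * hc + h4
  refine ⟨⟨g, 0⟩, ⟨⟨a, parity Δ - 2 * k, c⟩, hprim, hdisc⟩, ?_, ?_⟩
  · intro h; exact hg0 (congrArg QuadraticAlgebra.re h)
  · rw [hspan, formIdeal_eq (k := k) _ rfl]

theorem formClass_surjective : Function.Surjective (formClass (Δ := Δ)) := by
  intro C
  refine ClassGroup.induction (FractionRing (QuadOrder Δ)) (fun I => ?_) C
  · have hnum := FractionalIdeal.isUnit_num.2 I.isUnit
    obtain ⟨x, q, hx, hq⟩ := exists_formIdeal _ hnum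
    refine ⟨q, ?_⟩
    have hden : algebraMap (QuadOrder Δ) (FractionRing (QuadOrder Δ)) I.1.den ≠ 0 :=
      IsFractionRing.to_map_ne_zero_of_mem_nonZeroDivisors (SetLike.coe_mem _)
    have h1 : ClassGroup.mk (FractionRing (QuadOrder Δ)) I =
        ClassGroup.mk (FractionRing (QuadOrder Δ)) hnum.unit := by
      rw [ClassGroup.mk_eq_mk]
      refine ⟨Units.mk0 _ hden, ?_⟩
      apply Units.ext
      rw [mul_comm, Units.val_mul, coe_toPrincipalIdeal, Units.val_mk0]
      exact FractionalIdeal.den_mul_self_eq_num' (QuadOrder Δ)⁰ (FractionRing (QuadOrder Δ)) I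
    rw [h1, formClass]
    refine (ClassGroup.mk_eq_mk_of_coe_ideal rfl rfl).2 ⟨x, 1, hx, one_ne_zero, ?_⟩
    rw [← hq, Ideal.span_singleton_one, Ideal.one_eq_top.symm, one_mul]

/-- The bijection `[a, b, c] ↦ ⟨ω + (π - b) / 2, a⟩` between classes of forms and ideal classes. -/
noncomputable def ClTw.equivClassGroup : ClTw ℤ Δ ≃ ClassGroup (QuadOrder Δ) :=
  Equiv.ofBijective (Quotient.lift formClass fun _ _ h => formClass_eq_of_equiv h)
    ⟨by
      rintro ⟨q⟩ ⟨q'⟩ h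
      exact Quotient.sound (equiv_of_formClass_eq h),
    fun C => by
      obtain ⟨q, hq⟩ := formClass_surjective C
      exact ⟨ClTw.mk q, hq⟩⟩

/-- The composition law on classes of forms, transported from the ideal class group. -/
noncomputable instance : CommGroup (ClTw ℤ Δ) := ClTw.equivClassGroup.commGroup

end Order

/-- The set of values of `q` in `(ℤ / Δ)ˣ`. -/
def val (Δ : ℤ) (q : BinForm ℤ) : Set (ZMod Δ.natAbs)ˣ :=
  {u | ∃ x y : ZMod Δ.natAbs, (q.map (Int.castRingHom (ZMod Δ.natAbs))).eval x y = u}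

/-- The set of values of a class: the union of the sets of values of its representatives. -/
def classVal {Δ : ℤ} (C : ClTw ℤ Δ) : Set (ZMod Δ.natAbs)ˣ :=
  {u | ∃ q : PrimForm ℤ Δ, ClTw.mk q = C ∧ u ∈ val Δ q.1}

/-- The set of values of the principal form, as a subgroup of `(ℤ / Δ)ˣ`. -/
def valSubgroup (Δ : ℤ) : Subgroup (ZMod Δ.natAbs)ˣ where
  carrier := val Δ (principalForm Δ)
  one_mem' := ⟨1, 0, by simp [principalForm, BinForm.map, BinForm.eval]⟩
  mul_mem' := by
    rintro u v ⟨x, y, h⟩ ⟨x', y', h'⟩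
    simp only [principalForm, BinForm.map, BinForm.eval, map_neg, map_one] at h h'
    refine ⟨x * x' + Int.castRingHom _ ((Δ - parity Δ ^ 2) / 4) * y * y',
      x * y' + x' * y + Int.castRingHom _ (parity Δ) * y * y', ?_⟩
    simp only [principalForm, BinForm.map, BinForm.eval, map_neg, map_one]
    rw [Units.val_mul, ← h, ← h']
    ring
  inv_mem' := by
    rintro u ⟨x, y, h⟩
    refine ⟨x * (u⁻¹ : (ZMod Δ.natAbs)ˣ), y * (u⁻¹ : (ZMod Δ.natAbs)ˣ), ?_⟩
    have h2 : ((u⁻¹ : (ZMod Δ.natAbs)ˣ) : ZMod Δ.natAbs) * u = 1 := u.inv_mul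
    simp only [BinForm.eval] at h ⊢
    linear_combination ((u⁻¹ : (ZMod Δ.natAbs)ˣ) : ZMod Δ.natAbs) ^ 2 * h +
      ((u⁻¹ : (ZMod Δ.natAbs)ˣ) : ZMod Δ.natAbs) * h2

/-- The subgroup `± Val_Δ(q₀)` of `(ℤ / Δ)ˣ`. -/
def pmValSubgroup (Δ : ℤ) : Subgroup (ZMod Δ.natAbs)ˣ where
  carrier := {u | u ∈ valSubgroup Δ ∨ -u ∈ valSubgroup Δ}
  one_mem' := Or.inl (one_mem _)
  mul_mem' := by
    rintro u v (hu | hu) (hv | hv)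
    · exact Or.inl (mul_mem hu hv)
    · exact Or.inr (by simpa using mul_mem hu hv)
    · exact Or.inr (by simpa using mul_mem hu hv)
    · exact Or.inl (by simpa using mul_mem hu hv)
  inv_mem' := by
    rintro u (hu | hu)
    · exact Or.inl (inv_mem hu)
    · exact Or.inr (by simpa using inv_mem hu)

/-- A positive odd representative of a unit modulo `n`. -/
def oddRep {n : ℕ} (u : (ZMod n)ˣ) : ℕ :=
  if u.val.val % 2 = 1 then u.val.val else u.val.val + n

section Character


open NumberTheorySymbols

variable {Δ : ℤ} [hΔ : NegDisc Δ]

theorem jacobiSym_congr {m n : ℕ} (hm : Odd m) (hn : Odd n)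
    (h : (m : ZMod Δ.natAbs) = n) : J(Δ | m) = J(Δ | n) := by
  rw [ZMod.natCast_eq_natCast_iff] at h
  rcases hΔ.mod_four with h4 | h4
  · have h4' : Δ % 4 = 0 := h4
    rw [← jacobiSym.div_four_left h4' (Nat.odd_iff.1 hm),
      ← jacobiSym.div_four_left h4' (Nat.odd_iff.1 hn), jacobiSym.mod_right _ hm,
      jacobiSym.mod_right _ hn]
    have : 4 * (Δ / 4).natAbs = Δ.natAbs := by omega
    rw [this, h]
  · have h4' : Δ % 4 = 1 := h4
    have key : ∀ m : ℕ, Odd m → J(Δ | m) = J(m | Δ.natAbs) := by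
      intro m hm
      have hneg := hΔ.neg
      have hD : Δ.natAbs % 4 = 3 := by omega
      have e : Δ = -1 * (Δ.natAbs : ℤ) := by omega
      conv_lhs => rw [e]
      rw [jacobiSym.mul_left, jacobiSym.at_neg_one hm]
      rcases Nat.odd_mod_four_iff.1 (Nat.odd_iff.1 hm) with h1 | h3
      · rw [ZMod.χ₄_nat_one_mod_four h1, one_mul,
          jacobiSym.quadratic_reciprocity_one_mod_four h1 (Nat.odd_iff.2 (by omega))]
      · rw [ZMod.χ₄_nat_three_mod_four h3,
          jacobiSym.quadratic_reciprocity_three_mod_four hD h3]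
        ring
    rw [key m hm, key n hn]
    exact jacobiSym.mod_left' (by exact_mod_cast h)

instance : NeZero Δ.natAbs := ⟨by have := hΔ.neg; omega⟩

theorem oddRep_odd (u : (ZMod Δ.natAbs)ˣ) : Odd (oddRep u) := by
  unfold oddRep
  split_ifs with h
  · exact Nat.odd_iff.2 h
  · have hcop := ZMod.val_coe_unit_coprime u
    rw [Nat.odd_iff]
    by_contra h2
    have h3 : 2 ∣ Nat.gcd u.val.val Δ.natAbs := Nat.dvd_gcd (by omega) (by omega)
    rw [hcop] at h3
    omega

theorem oddRep_cast (u : (ZMod Δ.natAbs)ˣ) : (oddRep u : ZMod Δ.natAbs) = u := by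
  unfold oddRep
  split_ifs with h <;> simp

/-- The Dirichlet character `χ` modulo `Δ`, with `χ(p) = (Δ / p)` for odd primes `p ∤ Δ`:
the Jacobi symbol `(Δ / m)` at a positive odd representative `m` of the residue class. -/
def discChar (Δ : ℤ) [NegDisc Δ] : (ZMod Δ.natAbs)ˣ →* ℤˣ :=
  MonoidHom.toHomUnits
    { toFun := fun u => J(Δ | oddRep u)
      map_one' := by
        rw [jacobiSym_congr (oddRep_odd 1) odd_one (by rw [oddRep_cast]; simp),
          jacobiSym.one_right]
      map_mul' := fun u v => by
        rw [← jacobiSym.mul_right' Δ (oddRep_odd u).pos.ne' (oddRep_odd v).pos.ne']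
        exact jacobiSym_congr (oddRep_odd _) ((oddRep_odd u).mul (oddRep_odd v))
          (by push_cast; simp only [oddRep_cast, Units.val_mul]) }

theorem discChar_prime (p : ℕ) [hp : Fact p.Prime] (hp2 : p ≠ 2) (hpΔ : p.Coprime Δ.natAbs) :
    (discChar Δ (ZMod.unitOfCoprime p hpΔ) : ℤ) = legendreSym p Δ := by
  rw [jacobiSym.legendreSym.to_jacobiSym]
  exact jacobiSym_congr (oddRep_odd _) (hp.1.odd_of_ne_two hp2) (by rw [oddRep_cast]; simp)

theorem discChar_unique (χ : (ZMod Δ.natAbs)ˣ →* ℤˣ)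
    (h : ∀ (p : ℕ) [Fact p.Prime] (_ : p ≠ 2) (hpΔ : p.Coprime Δ.natAbs),
      (χ (ZMod.unitOfCoprime p hpΔ) : ℤ) = legendreSym p Δ) : χ = discChar Δ := by
  ext u
  obtain ⟨p, hp2, hp, hpu⟩ := Nat.forall_exists_prime_gt_and_eq_mod u.isUnit 2
  have : Fact p.Prime := ⟨hp⟩
  have hc : p.Coprime Δ.natAbs := (ZMod.isUnit_iff_coprime p _).1 (hpu ▸ u.isUnit)
  have hu : u = ZMod.unitOfCoprime p hc := Units.ext (by simp [hpu])
  rw [hu, h p (by omega) hc, discChar_prime p (by omega) hc]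

end Character

/-- The map `φ : ker χ / Val_Δ(q₀) → (ℤ / Δ)ˣ / ± Val_Δ(q₀)` induced by the inclusion of `ker χ`. -/
def phi (Δ : ℤ) [NegDisc Δ] :
    (discChar Δ).ker ⧸ (valSubgroup Δ).subgroupOf (discChar Δ).ker →*
      (ZMod Δ.natAbs)ˣ ⧸ pmValSubgroup Δ :=
  QuotientGroup.map _ _ (discChar Δ).ker.subtype fun _ hu => Or.inl hu

/-- `ψ` sends each class of forms to its set of values, seen as a coset of `± Val_Δ(q₀)`. -/
def IsGenusHom {Δ : ℤ} [NegDisc Δ] (ψ : ClTw ℤ Δ →* (ZMod Δ.natAbs)ˣ ⧸ pmValSubgroup Δ) : Prop :=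
  ∀ C : ClTw ℤ Δ, {u : (ZMod Δ.natAbs)ˣ | (u : (ZMod Δ.natAbs)ˣ ⧸ pmValSubgroup Δ) = ψ C} =
    classVal C

end GenusTheory

open GenusTheory

/-!
The identity `a q(x, y) = q₀(a x - k y, y)` with `b = π - 2 k` makes the values of `q = [a, b, c]`,
for `a` prime to `Δ`, the coset of `a` modulo `Val(q₀)`, and the twists of determinant `-1` add the
sign. Composition of forms with common middle coefficient multiplies the leading coefficients, so
`ψ` is a homomorphism. Since `Δ < 0`, the form `q₀` is nonnegative and `χ(-1) = -1`, which gives the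
assertions on `φ`; surjectivity of `ψ` follows from Dirichlet's theorem on primes `p ≡ u` with
`χ(u) = 1`, as `Δ` is then a square modulo `4 p`.

Duplication is Gauss' argument. If `q` takes the value `1` modulo `Δ`, it is the restriction to a
plane of a ternary form of half-discriminant `-1`. By Hermite reduction that form is equivalent to
`x z + y²`, the discriminant form of `u² L₀ + 2 u v L₁ - v² L₂`. So `q` properly represents a square
`m²` with `m` prime to `Δ`, and `[m², b, c]` is the square of `[m, b, m c]`.
-/

namespace GenusTheory

open scoped MatrixGroups
open NumberTheorySymbols

/-! ### Binary forms -/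

theorem isCoprime_of_modEq {n a b : ℤ} (h : a ≡ b [ZMOD n]) (ha : IsCoprime a n) :
    IsCoprime b n := by
  obtain ⟨t, ht⟩ := h.dvd
  rw [eq_add_of_sub_eq' ht]
  exact ha.add_mul_left_left t

theorem exists_modEq_and_modEq {m n : ℤ} (h : IsCoprime m n) (a b : ℤ) :
    ∃ x, x ≡ a [ZMOD m] ∧ x ≡ b [ZMOD n] := by
  obtain ⟨s, t, hst⟩ := h
  exact ⟨a * (t * n) + b * (s * m),
    (Int.modEq_iff_dvd.2 ⟨s * (a - b), by linear_combination (-a) * hst⟩),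
    (Int.modEq_iff_dvd.2 ⟨t * (b - a), by linear_combination (-b) * hst⟩)⟩

theorem exists_isCoprime_eq_mul (x y : ℤ) :
    ∃ x' y' t : ℤ, IsCoprime x' y' ∧ x = x' * t ∧ y = y' * t := by
  rcases Nat.eq_zero_or_pos (Int.gcd x y) with h | h
  · obtain ⟨rfl, rfl⟩ := Int.gcd_eq_zero_iff.1 h
    exact ⟨1, 0, 0, isCoprime_one_left, rfl, rfl⟩
  · obtain ⟨x', y', hxy, hx, hy⟩ := Int.exists_gcd_one h
    exact ⟨x', y', Int.gcd x y, Int.isCoprime_iff_gcd_eq_one.2 hxy, hx, hy⟩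

theorem exists_two_mul_abs_add_mul_le {m : ℤ} (hm : m ≠ 0) (n : ℤ) :
    ∃ k, 2 * |n + m * k| ≤ |m| := by
  have hdiv := Int.emod_add_mul_ediv n m
  have hnonneg := Int.emod_nonneg n hm
  have hlt := Int.emod_lt_abs n hm
  rcases le_total (2 * (n % m)) |m| with h | h
  · refine ⟨-(n / m), ?_⟩
    rwa [show n + m * -(n / m) = n % m by linarith, abs_of_nonneg hnonneg]
  · refine ⟨-(n / m) - m.sign, ?_⟩
    have hsign : m * m.sign = |m| := by rw [Int.mul_sign_self, Int.natCast_natAbs]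
    rw [show n + m * (-(n / m) - m.sign) = n % m - |m| by linarith, abs_of_neg (by linarith)]
    linarith

namespace BinForm

section CommRing

variable {R : Type*} [CommRing R]

theorem disc_twist (q : BinForm R) (M : GL (Fin 2) R) : (q.twist M).disc = q.disc := by
  have hdet : ((Matrix.GeneralLinearGroup.det M)⁻¹ : Rˣ) *
      (M 0 0 * M 1 1 - M 0 1 * M 1 0) = (1 : R) := by
    rw [← Matrix.det_fin_two, ← Matrix.GeneralLinearGroup.val_det_apply, Units.inv_mul]
  simp only [disc, twist, eval]
  linear_combination (q.b ^ 2 - 4 * q.a * q.c) *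
    (((Matrix.GeneralLinearGroup.det M)⁻¹ : Rˣ) * (M 0 0 * M 1 1 - M 0 1 * M 1 0) + 1) * hdet

theorem span_coeffs_twist_le (q : BinForm R) (M : GL (Fin 2) R) :
    Ideal.span {(q.twist M).a, (q.twist M).b, (q.twist M).c} ≤ Ideal.span {q.a, q.b, q.c} := by
  rw [Ideal.span_le]
  rintro _ (rfl | rfl | rfl) <;> refine Ideal.mul_mem_left _ _ (Submodule.mem_span_triple.2 ?_)
  · exact ⟨M 0 0 ^ 2, M 0 0 * M 1 0, M 1 0 ^ 2, by simp only [eval, smul_eq_mul]; ring⟩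
  · exact ⟨2 * M 0 0 * M 0 1, M 0 0 * M 1 1 + M 0 1 * M 1 0, 2 * M 1 0 * M 1 1,
      by simp only [smul_eq_mul]; ring⟩
  · exact ⟨M 0 1 ^ 2, M 0 1 * M 1 1, M 1 1 ^ 2, by simp only [eval, smul_eq_mul]; ring⟩

theorem IsPrimitive.twist {q : BinForm R} (hq : q.IsPrimitive) (M : GL (Fin 2) R) :
    (q.twist M).IsPrimitive := by
  have h := (q.twist M).span_coeffs_twist_le M⁻¹
  rw [twist_twist, mul_inv_cancel, twist_one, show Ideal.span {q.a, q.b, q.c} = ⊤ from hq] at h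
  exact top_le_iff.1 h

theorem isPrimitive_of_isCoprime {q : BinForm R} (h : IsCoprime q.a q.disc) : q.IsPrimitive := by
  obtain ⟨r, s, hrs⟩ := h
  rw [IsPrimitive, Ideal.eq_top_iff_one]
  refine Submodule.mem_span_triple.2 ⟨r - 4 * s * q.c, s * q.b, 0, ?_⟩
  simp only [disc, smul_eq_mul] at hrs ⊢
  linear_combination hrs

theorem twist_coe_SL_a (q : BinForm R) (g : SL(2, R)) :
    (q.twist (g : GL (Fin 2) R)).a = q.eval (g 0 0) (g 1 0) := by
  simp [twist]

theorem twist_coe_SL_b (q : BinForm R) (g : SL(2, R)) :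
    (q.twist (g : GL (Fin 2) R)).b = 2 * q.a * g 0 0 * g 0 1 +
      q.b * (g 0 0 * g 1 1 + g 0 1 * g 1 0) + 2 * q.c * g 1 0 * g 1 1 := by
  simp [twist]

theorem exists_twist_a_eq_eval (q : BinForm R) {x y : R} (h : IsCoprime x y) :
    ∃ g : SL(2, R), (q.twist (g : GL (Fin 2) R)).a = q.eval x y := by
  obtain ⟨g, hx, hy⟩ := h.exists_SL2_col 0
  exact ⟨g, by rw [twist_coe_SL_a, hx, hy]⟩

theorem eval_mul_mul (q : BinForm R) (x y t : R) :
    q.eval (x * t) (y * t) = q.eval x y * t ^ 2 := by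
  simp only [eval]
  ring

theorem exists_eval_dvd_sq_sub_disc (q : BinForm R) {x y : R} (h : IsCoprime x y) :
    ∃ b : R, q.eval x y ∣ b ^ 2 - q.disc := by
  obtain ⟨g, hg⟩ := q.exists_twist_a_eq_eval h
  refine ⟨(q.twist (g : GL (Fin 2) R)).b, 4 * (q.twist (g : GL (Fin 2) R)).c, ?_⟩
  rw [← hg, ← q.disc_twist g, disc]
  ring

end CommRing

theorem eval_modEq (q : BinForm ℤ) {n x x' y y' : ℤ} (hx : x ≡ x' [ZMOD n])
    (hy : y ≡ y' [ZMOD n]) : q.eval x y ≡ q.eval x' y' [ZMOD n] := by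
  unfold eval
  gcongr

theorem exists_not_dvd_eval {q : BinForm ℤ} (hq : q.IsPrimitive) {p : ℤ} (hp : Prime p) :
    ∃ x y : ℤ, ¬ p ∣ q.eval x y := by
  by_contra! h
  have ha : p ∣ q.a := by simpa [eval] using h 1 0
  have hc : p ∣ q.c := by simpa [eval] using h 0 1
  have hb : p ∣ q.b := by
    have hsum : q.eval 1 1 - (q.a + q.c) = q.b := by
      simp only [eval]
      ring
    exact hsum ▸ dvd_sub (h 1 1) (dvd_add ha hc)
  refine hp.not_isUnit (Ideal.span_singleton_eq_top.1 (top_le_iff.1 (hq.ge.trans ?_)))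
  rw [Ideal.span_le]
  rintro z (rfl | rfl | rfl) <;> exact Ideal.mem_span_singleton.2 ‹_›

theorem exists_isCoprime_eval {q : BinForm ℤ} (hq : q.IsPrimitive) {n : ℕ} (hn : n ≠ 0) :
    ∃ x y : ℤ, IsCoprime (q.eval x y) n := by
  induction n using Nat.recOnPosPrimePosCoprime with
  | zero => exact absurd rfl hn
  | one => exact ⟨0, 0, isCoprime_one_right⟩
  | prime_pow p k hp _ =>
    obtain ⟨x, y, h⟩ := exists_not_dvd_eval hq (Nat.prime_iff_prime_int.1 hp)
    refine ⟨x, y, ?_⟩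
    rw [Nat.cast_pow]
    exact ((Nat.prime_iff_prime_int.1 hp).coprime_iff_not_dvd.2 h).symm.pow_right
  | coprime m k hm hk hmk ihm ihk =>
    obtain ⟨x₁, y₁, h₁⟩ := ihm (by omega)
    obtain ⟨x₂, y₂, h₂⟩ := ihk (by omega)
    have hmk' : IsCoprime (m : ℤ) k := Nat.isCoprime_iff_coprime.2 hmk
    obtain ⟨x, hx₁, hx₂⟩ := exists_modEq_and_modEq hmk' x₁ x₂
    obtain ⟨y, hy₁, hy₂⟩ := exists_modEq_and_modEq hmk' y₁ y₂
    refine ⟨x, y, ?_⟩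
    rw [Nat.cast_mul]
    exact (isCoprime_of_modEq (q.eval_modEq hx₁ hy₁).symm h₁).mul_right
      (isCoprime_of_modEq (q.eval_modEq hx₂ hy₂).symm h₂)

theorem exists_isCoprime_eval_eq_mul_sq (q : BinForm ℤ) (x y : ℤ) :
    ∃ x' y' t : ℤ, IsCoprime x' y' ∧ q.eval x y = q.eval x' y' * t ^ 2 := by
  obtain ⟨x', y', t, hxy, rfl, rfl⟩ := exists_isCoprime_eq_mul x y
  exact ⟨x', y', t, hxy, q.eval_mul_mul x' y' t⟩

theorem exists_isCoprime_isCoprime_eval {q : BinForm ℤ} (hq : q.IsPrimitive) {n : ℤ}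
    (hn : n ≠ 0) : ∃ x y : ℤ, IsCoprime x y ∧ IsCoprime (q.eval x y) n := by
  obtain ⟨x, y, h⟩ := exists_isCoprime_eval hq (Int.natAbs_ne_zero.2 hn)
  obtain ⟨x', y', t, hxy, he⟩ := q.exists_isCoprime_eval_eq_mul_sq x y
  rw [he] at h
  exact ⟨x', y', hxy,
    h.of_mul_left_left.of_isCoprime_of_dvd_right (Int.dvd_natAbs.2 dvd_rfl)⟩

/- Gauss' reduction: a leading coefficient `a` of least absolute value in the orbit satisfies
`|a| ≤ |c|`, and a translation makes `|b| ≤ |a|`. -/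
theorem exists_isCoprime_three_mul_eval_sq_le (q : BinForm ℤ) :
    ∃ x y : ℤ, IsCoprime x y ∧ 3 * q.eval x y ^ 2 ≤ |q.disc| := by
  let leading (g : SL(2, ℤ)) : ℕ := (q.twist (g : GL (Fin 2) ℤ)).a.natAbs
  let g := Function.argmin leading
  refine ⟨g 0 0, g 1 0, g.isCoprime_col 0, ?_⟩
  rw [← twist_coe_SL_a, ← q.disc_twist g]
  set r := q.twist (g : GL (Fin 2) ℤ) with hr
  rcases eq_or_ne r.a 0 with ha | ha
  · simp [ha]
  have hmin (k : ℤ) : |r.a| ≤ |r.eval k 1| := by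
    obtain ⟨h, hh⟩ := r.exists_twist_a_eq_eval (isCoprime_one_right (x := k))
    rw [← hh, hr, twist_twist, ← map_mul, Int.abs_eq_natAbs, Int.abs_eq_natAbs,
      Nat.cast_le]
    exact Function.argmin_le leading (g * h)
  obtain ⟨k, hk⟩ := exists_two_mul_abs_add_mul_le (mul_ne_zero two_ne_zero ha) r.b
  have hb : |r.b + 2 * r.a * k| ≤ |r.a| := by
    rw [abs_mul, abs_two] at hk
    linarith
  have hdisc : 4 * (r.a * r.eval k 1) = (r.b + 2 * r.a * k) ^ 2 - r.disc := by
    simp only [disc, eval]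
    ring
  calc 3 * r.a ^ 2 = 4 * (|r.a| * |r.a|) - r.a ^ 2 := by rw [abs_mul_abs_self]; ring
    _ ≤ 4 * (|r.a| * |r.eval k 1|) - r.a ^ 2 := by
      linarith [mul_le_mul_of_nonneg_left (hmin k) (abs_nonneg r.a)]
    _ = |(r.b + 2 * r.a * k) ^ 2 - r.disc| - r.a ^ 2 := by
      rw [← hdisc, abs_mul, abs_mul, abs_of_pos (four_pos : (0 : ℤ) < 4)]
    _ ≤ (r.b + 2 * r.a * k) ^ 2 + |r.disc| - r.a ^ 2 := by
      gcongr
      exact (abs_sub _ _).trans_eq (by rw [abs_sq])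
    _ ≤ |r.disc| := by linarith [sq_le_sq.2 hb]

end BinForm

/-! ### Ternary forms -/

/-- The ternary quadratic form `a x² + b y² + c z² + d y z + e x z + f x y`; a binary form with
value `1` modulo its discriminant extends to one of half-discriminant `-1`. -/
@[ext]
structure TernForm (R : Type*) where
  a : R
  b : R
  c : R
  d : R
  e : R
  f : R

namespace TernForm

section CommRing

variable {R : Type*} [CommRing R]

/-- The value `Q(x, y, z)`. -/
def eval (Q : TernForm R) (x y z : R) : R :=
  Q.a * x ^ 2 + Q.b * y ^ 2 + Q.c * z ^ 2 + Q.d * y * z + Q.e * x * z + Q.f * x * y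

/-- The polar form `Q(v + w) - Q(v) - Q(w)`. -/
def polar (Q : TernForm R) (x y z x' y' z' : R) : R :=
  2 * Q.a * x * x' + 2 * Q.b * y * y' + 2 * Q.c * z * z' + Q.d * (y * z' + y' * z) +
    Q.e * (x * z' + x' * z) + Q.f * (x * y' + x' * y)

/-- Half of the determinant of the Gram matrix of the polar form, which is an integral polynomial
in the coefficients. -/
def halfDisc (Q : TernForm R) : R :=
  4 * Q.a * Q.b * Q.c + Q.d * Q.e * Q.f - Q.a * Q.d ^ 2 - Q.b * Q.e ^ 2 - Q.c * Q.f ^ 2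

/-- The form `v ↦ Q(M v)`. -/
def subst (Q : TernForm R) (M : Matrix (Fin 3) (Fin 3) R) : TernForm R where
  a := Q.eval (M 0 0) (M 1 0) (M 2 0)
  b := Q.eval (M 0 1) (M 1 1) (M 2 1)
  c := Q.eval (M 0 2) (M 1 2) (M 2 2)
  d := Q.polar (M 0 1) (M 1 1) (M 2 1) (M 0 2) (M 1 2) (M 2 2)
  e := Q.polar (M 0 0) (M 1 0) (M 2 0) (M 0 2) (M 1 2) (M 2 2)
  f := Q.polar (M 0 0) (M 1 0) (M 2 0) (M 0 1) (M 1 1) (M 2 1)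

theorem eval_subst (Q : TernForm R) (M : Matrix (Fin 3) (Fin 3) R) (x y z : R) :
    (Q.subst M).eval x y z = Q.eval (M 0 0 * x + M 0 1 * y + M 0 2 * z)
      (M 1 0 * x + M 1 1 * y + M 1 2 * z) (M 2 0 * x + M 2 1 * y + M 2 2 * z) := by
  simp only [subst, eval, polar]
  ring

theorem subst_one (Q : TernForm R) : Q.subst 1 = Q := by
  ext <;> simp [subst, eval, polar]

theorem subst_subst (Q : TernForm R) (M N : Matrix (Fin 3) (Fin 3) R) :
    (Q.subst M).subst N = Q.subst (M * N) := by
  ext <;> simp only [subst, eval, polar, Matrix.mul_apply, Fin.sum_univ_three] <;> ring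

theorem halfDisc_subst (Q : TernForm R) (M : Matrix (Fin 3) (Fin 3) R) :
    (Q.subst M).halfDisc = M.det ^ 2 * Q.halfDisc := by
  simp only [halfDisc, subst, eval, polar, Matrix.det_fin_three]
  ring

theorem halfDisc_subst_SL (Q : TernForm R) (g : SL(3, R)) :
    (Q.subst g).halfDisc = Q.halfDisc := by
  rw [halfDisc_subst, g.det_coe, one_pow, one_mul]

/-- The binary form `r` with `4 a Q(x, y, z) = (2 a x + f y + e z)² + r(y, z)`. -/
def residue (Q : TernForm R) : BinForm R :=
  ⟨4 * Q.a * Q.b - Q.f ^ 2, 4 * Q.a * Q.d - 2 * Q.e * Q.f, 4 * Q.a * Q.c - Q.e ^ 2⟩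

theorem four_mul_a_mul_eval (Q : TernForm R) (x y z : R) :
    4 * (Q.a * Q.eval x y z) = (Q.f * y + Q.e * z + 2 * Q.a * x) ^ 2 + Q.residue.eval y z := by
  simp only [eval, residue, BinForm.eval]
  ring

theorem disc_residue (Q : TernForm R) : Q.residue.disc = -(16 * (Q.a * Q.halfDisc)) := by
  simp only [residue, BinForm.disc, halfDisc]
  ring

theorem exists_subst_a_eq_eval (Q : TernForm R) (x : R) {y z : R} (h : IsCoprime y z) :
    ∃ g : SL(3, R), (Q.subst g).a = Q.eval x y z := by
  obtain ⟨s, t, hst⟩ := h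
  refine ⟨⟨!![x, -1, 0; y, 0, -t; z, 0, s], ?_⟩, rfl⟩
  simp only [Matrix.det_fin_three, Matrix.of_apply, Matrix.cons_val]
  linear_combination hst

theorem exists_subst_eq_of_a_eq_zero {Q : TernForm R} (ha : Q.a = 0) (h : IsUnit Q.halfDisc) :
    ∃ g : SL(3, R), Q.subst g = ⟨0, -Q.halfDisc, 0, 0, 1, 0⟩ := by
  obtain ⟨u, hu⟩ := h.exists_left_inv
  obtain ⟨α, β, hαβ⟩ : ∃ α β, α * Q.e + β * Q.f = 1 := by
    refine ⟨u * (Q.d * Q.f - Q.b * Q.e), -(u * Q.c * Q.f), ?_⟩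
    rw [← hu, halfDisc, ha]
    ring
  let g : SL(3, R) := ⟨!![1, 0, 0; 0, Q.e, β; 0, -Q.f, α], by
    simp only [Matrix.det_fin_three, Matrix.of_apply, Matrix.cons_val]
    linear_combination hαβ⟩
  obtain ⟨P, hP⟩ : ∃ P, P = Q.subst g := ⟨_, rfl⟩
  have hPa : P.a = 0 := by
    simp only [hP, subst, eval, g, ha, Matrix.of_apply, Matrix.cons_val]
    ring
  have hPf : P.f = 0 := by
    simp only [hP, subst, polar, g, ha, Matrix.of_apply, Matrix.cons_val]
    ring
  have hPe : P.e = 1 := by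
    simp only [hP, subst, polar, g, ha, Matrix.of_apply, Matrix.cons_val]
    linear_combination hαβ
  have hPb : P.b = -Q.halfDisc := by
    have hdisc := Q.halfDisc_subst_SL g
    rw [← hP, halfDisc, hPa, hPf, hPe] at hdisc
    linear_combination -hdisc
  let s : SL(3, R) := ⟨!![1, -P.d, -P.c; 0, 1, 0; 0, 0, 1], by simp [Matrix.det_fin_three]⟩
  refine ⟨g * s, ?_⟩
  rw [Matrix.SpecialLinearGroup.coe_mul, ← subst_subst, ← hP]
  ext <;> simp [subst, eval, polar, s, hPa, hPf, hPe, hPb]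

end CommRing

/- Hermite's reduction: for `a` of least absolute value in the orbit, first choose `(y, z)` with
`residue y z` small, then translate `x` to make `2 a x + f y + e z` small. -/
theorem exists_subst_a_bound (Q : TernForm ℤ) :
    ∃ g : SL(3, ℤ), 27 * |(Q.subst g).a| ^ 3 ≤ 16 * |Q.halfDisc| := by
  let leading (g : SL(3, ℤ)) : ℕ := (Q.subst g).a.natAbs
  let g := Function.argmin leading
  refine ⟨g, ?_⟩
  obtain ⟨P, hP⟩ : ∃ P, P = Q.subst g := ⟨_, rfl⟩
  rw [← Q.halfDisc_subst_SL g, ← hP]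
  rcases eq_or_ne P.a 0 with ha | ha
  · simp [ha]
  obtain ⟨y, z, hyz, hres⟩ := P.residue.exists_isCoprime_three_mul_eval_sq_le
  obtain ⟨x, hx⟩ := exists_two_mul_abs_add_mul_le (mul_ne_zero two_ne_zero ha) (P.f * y + P.e * z)
  have hmin : |P.a| ≤ |P.eval x y z| := by
    obtain ⟨h, hh⟩ := P.exists_subst_a_eq_eval x hyz
    rw [← hh, hP, subst_subst, ← Matrix.SpecialLinearGroup.coe_mul, Int.abs_eq_natAbs,
      Int.abs_eq_natAbs, Nat.cast_le]
    exact Function.argmin_le leading (g * h)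
  have hlin : (P.f * y + P.e * z + 2 * P.a * x) ^ 2 ≤ P.a ^ 2 := by
    rw [abs_mul, abs_two] at hx
    exact sq_le_sq.2 (by linarith)
  have hres_ge : 3 * P.a ^ 2 ≤ |P.residue.eval y z| := by
    have habs := abs_add_le ((P.f * y + P.e * z + 2 * P.a * x) ^ 2) (P.residue.eval y z)
    rw [← four_mul_a_mul_eval, abs_mul, abs_mul, abs_sq, abs_of_pos (four_pos : (0 : ℤ) < 4)]
      at habs
    linarith [mul_le_mul_of_nonneg_left hmin (abs_nonneg P.a), abs_mul_abs_self P.a]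
  refine le_of_mul_le_mul_left ?_ (abs_pos.2 ha)
  calc |P.a| * (27 * |P.a| ^ 3) = 3 * (3 * P.a ^ 2) ^ 2 := by rw [← sq_abs P.a]; ring
    _ ≤ 3 * |P.residue.eval y z| ^ 2 := by gcongr
    _ = 3 * P.residue.eval y z ^ 2 := by rw [sq_abs]
    _ ≤ |P.residue.disc| := hres
    _ = |P.a| * (16 * |P.halfDisc|) := by
      rw [disc_residue, abs_neg, abs_mul, abs_mul, abs_of_pos (by norm_num : (0 : ℤ) < 16)]
      ring

theorem exists_subst_eq_of_isUnit_halfDisc {Q : TernForm ℤ} (h : IsUnit Q.halfDisc) :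
    ∃ g : SL(3, ℤ), Q.subst g = ⟨0, -Q.halfDisc, 0, 0, 1, 0⟩ := by
  obtain ⟨g, hg⟩ := Q.exists_subst_a_bound
  have ha : (Q.subst g).a = 0 := by
    rw [Int.isUnit_iff_abs_eq.1 h] at hg
    by_contra ha
    linarith [one_le_pow₀ (n := 3) (Int.one_le_abs ha)]
  obtain ⟨s, hs⟩ := exists_subst_eq_of_a_eq_zero ha (Q.halfDisc_subst_SL g ▸ h)
  exact ⟨g * s, by rw [Matrix.SpecialLinearGroup.coe_mul, ← subst_subst, hs, halfDisc_subst_SL]⟩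

end TernForm

/-! ### Forms with value `1` modulo the discriminant -/

section SquareValues

variable {R : Type*} [CommRing R]

/-- With `Lᵢ(x, y) = Nᵢ₀ x + Nᵢ₁ y`, the form whose value at `(u, v)` is the `2 × 2` minor of
`u² L₀ + 2 u v L₁ - v² L₂` and `u u' L₀ + (u v' + u' v) L₁ - v v' L₂` whenever
`u v' - u' v = 1`. -/
def minorForm (N : Matrix (Fin 3) (Fin 3) R) : BinForm R where
  a := N 0 0 * N 1 1 - N 0 1 * N 1 0
  b := -(N 0 0 * N 2 1 - N 0 1 * N 2 0)
  c := -(N 1 0 * N 2 1 - N 1 1 * N 2 0)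

theorem isPrimitive_minorForm (N : SL(3, R)) : (minorForm (N : Matrix _ _ R)).IsPrimitive := by
  have hdet := N.det_coe
  rw [Matrix.det_fin_three] at hdet
  rw [BinForm.IsPrimitive, Ideal.eq_top_iff_one]
  refine Submodule.mem_span_triple.2 ⟨N 2 2, N 1 2, -N 0 2, ?_⟩
  simp only [minorForm, smul_eq_mul]
  linear_combination hdet

/- Changing `(u, v)` to a basis turns `L₁² + L₀ L₂` into `B² - A C`, where `A ∧ B` is the value of
`minorForm` at `(u, v)`; at the primitive zero of `A` only `B²` is left. -/
theorem exists_isCoprime_eq_sq (N : SL(3, ℤ)) {n : ℤ} (hn : n ≠ 0) :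
    ∃ x y m : ℤ, IsCoprime x y ∧ IsCoprime m n ∧
      (N 0 0 * x + N 0 1 * y) * (N 2 0 * x + N 2 1 * y) + (N 1 0 * x + N 1 1 * y) ^ 2 = m ^ 2 := by
  obtain ⟨u, v, ⟨v', u', huv⟩, hcop⟩ :=
    BinForm.exists_isCoprime_isCoprime_eval (isPrimitive_minorForm N) hn
  let A (i : Fin 3) : ℤ := u ^ 2 * N 0 i + 2 * u * v * N 1 i - v ^ 2 * N 2 i
  let B (i : Fin 3) : ℤ := -u * u' * N 0 i + (u * v' - u' * v) * N 1 i - v * v' * N 2 i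
  let C (i : Fin 3) : ℤ := u' ^ 2 * N 0 i - 2 * u' * v' * N 1 i - v' ^ 2 * N 2 i
  have hval (x y : ℤ) : (N 0 0 * x + N 0 1 * y) * (N 2 0 * x + N 2 1 * y) +
      (N 1 0 * x + N 1 1 * y) ^ 2 =
        (B 0 * x + B 1 * y) ^ 2 - (A 0 * x + A 1 * y) * (C 0 * x + C 1 * y) := by
    linear_combination (-(N 0 0 * x + N 0 1 * y) * (N 2 0 * x + N 2 1 * y) -
      (N 1 0 * x + N 1 1 * y) ^ 2) * (v' * u + u' * v + 1) * huv
  have hminor : A 0 * B 1 - A 1 * B 0 = (minorForm (N : Matrix _ _ ℤ)).eval u v := by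
    simp only [minorForm, BinForm.eval]
    linear_combination (u ^ 2 * (N 0 0 * N 1 1 - N 0 1 * N 1 0) -
      u * v * (N 0 0 * N 2 1 - N 0 1 * N 2 0) - v ^ 2 * (N 1 0 * N 2 1 - N 1 1 * N 2 0)) * huv
  obtain ⟨x, y, t, hxy, hx, hy⟩ := exists_isCoprime_eq_mul (-A 1) (A 0)
  refine ⟨x, y, B 0 * x + B 1 * y, hxy, hcop.of_isCoprime_of_dvd_left ⟨t, ?_⟩, ?_⟩
  · linear_combination -hminor + B 0 * hx + B 1 * hy
  · rw [hval]
    linear_combination (C 0 * x + C 1 * y) * (y * hx - x * hy)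

end SquareValues

theorem BinForm.exists_SL3_eval_eq {q : BinForm ℤ} {x y : ℤ} (h : q.disc ∣ q.eval x y - 1) :
    ∃ N : SL(3, ℤ), ∀ s t, q.eval s t =
      (N 0 0 * s + N 0 1 * t) * (N 2 0 * s + N 2 1 * t) + (N 1 0 * s + N 1 1 * t) ^ 2 := by
  obtain ⟨w, hw⟩ := h
  let Q : TernForm ℤ := ⟨q.a, q.c, -w, x, -y, q.b⟩
  have hQ : Q.halfDisc = -1 := by
    simp only [BinForm.disc, BinForm.eval] at hw
    simp only [TernForm.halfDisc, Q]
    linear_combination -hw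
  obtain ⟨g, hg⟩ := TernForm.exists_subst_eq_of_isUnit_halfDisc (hQ ▸ isUnit_one.neg)
  refine ⟨g⁻¹, fun s t => ?_⟩
  have hone : Q.subst g = ⟨0, 1, 0, 0, 1, 0⟩ := by rw [hg, hQ, neg_neg]
  have hsubst : Q = (Q.subst g).subst (g⁻¹ : SL(3, ℤ)) := by
    rw [TernForm.subst_subst, ← Matrix.SpecialLinearGroup.coe_mul, mul_inv_cancel,
      Matrix.SpecialLinearGroup.coe_one, TernForm.subst_one]
  calc q.eval s t = Q.eval s t 0 := by simp only [BinForm.eval, TernForm.eval, Q]; ring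
    _ = _ := by
      rw [hsubst, hone, TernForm.eval_subst, TernForm.eval]
      ring

theorem BinForm.exists_eval_eq_sq {q : BinForm ℤ} (hq : q.disc ≠ 0) {x y : ℤ}
    (h : q.disc ∣ q.eval x y - 1) :
    ∃ x y m : ℤ, IsCoprime x y ∧ IsCoprime m q.disc ∧ q.eval x y = m ^ 2 := by
  obtain ⟨N, hN⟩ := exists_SL3_eval_eq h
  simpa only [hN] using exists_isCoprime_eq_sq N hq

/-! ### The character `χ` -/

theorem intCast_zmod_natAbs_eq_iff {n z w : ℤ} : (z : ZMod n.natAbs) = w ↔ z ≡ w [ZMOD n] := by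
  rw [ZMod.intCast_eq_intCast_iff, Int.modEq_natAbs]

theorem isUnit_intCast_zmod_natAbs_iff {n z : ℤ} : IsUnit (z : ZMod n.natAbs) ↔ IsCoprime z n := by
  rw [ZMod.coe_int_isUnit_iff_isCoprime, isCoprime_comm, Int.natCast_natAbs,
    IsCoprime.abs_right_iff]

theorem mem_val_iff {Δ : ℤ} {q : BinForm ℤ} {u : (ZMod Δ.natAbs)ˣ} :
    u ∈ val Δ q ↔ ∃ x y : ℤ, ((q.eval x y : ℤ) : ZMod Δ.natAbs) = u := by
  have hmap (x y : ℤ) : (q.map (Int.castRingHom (ZMod Δ.natAbs))).eval x y = (q.eval x y : ℤ) := by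
    simp [BinForm.map, BinForm.eval]
  simp only [val, Set.mem_ofPred_eq, ZMod.intCast_surjective.exists, hmap]

theorem mem_valSubgroup_iff {Δ : ℤ} {u : (ZMod Δ.natAbs)ˣ} : u ∈ valSubgroup Δ ↔
    ∃ x y : ℤ, (((principalForm Δ).eval x y : ℤ) : ZMod Δ.natAbs) = u :=
  mem_val_iff

theorem mul_self_mem_valSubgroup {Δ : ℤ} (u : (ZMod Δ.natAbs)ˣ) : u * u ∈ valSubgroup Δ :=
  ⟨u, 0, by simp [principalForm, BinForm.map, BinForm.eval, sq]⟩

theorem mul_self_eq_one_of_quotient_pmValSubgroup {Δ : ℤ}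
    (g : (ZMod Δ.natAbs)ˣ ⧸ pmValSubgroup Δ) : g * g = 1 := by
  obtain ⟨u, rfl⟩ := QuotientGroup.mk_surjective g
  exact (QuotientGroup.eq_one_iff (u * u)).2 (Or.inl (mul_self_mem_valSubgroup u))

theorem mk_neg_eq_mk {Δ : ℤ} (u : (ZMod Δ.natAbs)ˣ) :
    ((-u : (ZMod Δ.natAbs)ˣ) : _ ⧸ pmValSubgroup Δ) = u :=
  QuotientGroup.eq.2 (Or.inr (by simp [one_mem]))

theorem jacobiSym_eq_one_of_dvd_sq_sub {z b : ℤ} {n : ℕ} (hz : IsCoprime z n)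
    (h : (n : ℤ) ∣ b ^ 2 - z) : J(z | n) = 1 := by
  have hmod : z ≡ b ^ 2 [ZMOD n] := Int.modEq_iff_dvd.2 h
  rw [jacobiSym.mod_left' hmod]
  exact jacobiSym.sq_one' (Int.isCoprime_iff_gcd_eq_one.1
    ((IsCoprime.pow_left_iff two_pos).1 (isCoprime_of_modEq hmod hz)))

theorem BinForm.jacobiSym_disc_natAbs_eval (q : BinForm ℤ) {x y : ℤ}
    (h : IsCoprime q.disc (q.eval x y)) : J(q.disc | (q.eval x y).natAbs) = 1 := by
  rcases eq_or_ne (q.eval x y) 0 with h0 | h0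
  · rw [h0, Int.natAbs_zero, jacobiSym.zero_right]
  obtain ⟨x', y', t, hxy, he⟩ := q.exists_isCoprime_eval_eq_mul_sq x y
  obtain ⟨b, hb⟩ := q.exists_eval_dvd_sq_sub_disc hxy
  rw [he] at h h0 ⊢
  have hm : IsCoprime q.disc ((q.eval x' y').natAbs : ℤ) :=
    h.of_mul_right_left.of_isCoprime_of_dvd_right (Int.natAbs_dvd.2 dvd_rfl)
  have ht : IsCoprime q.disc (t.natAbs : ℤ) :=
    ((IsCoprime.pow_right_iff two_pos).1 h.of_mul_right_right).of_isCoprime_of_dvd_right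
      (Int.natAbs_dvd.2 dvd_rfl)
  rw [Int.natAbs_mul, Int.natAbs_pow,
    jacobiSym.mul_right' _ (Int.natAbs_ne_zero.2 (left_ne_zero_of_mul h0))
      (pow_ne_zero 2 (Int.natAbs_ne_zero.2 (pow_ne_zero_iff two_ne_zero |>.1
        (right_ne_zero_of_mul h0)))),
    jacobiSym.pow_right, jacobiSym.sq_one (Int.isCoprime_iff_gcd_eq_one.1 ht), mul_one]
  exact jacobiSym_eq_one_of_dvd_sq_sub hm (Int.natAbs_dvd.2 hb)

theorem exists_odd_eval_principalForm {Δ : ℤ} {u : (ZMod Δ.natAbs)ˣ}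
    (hu : u ∈ valSubgroup Δ) : ∃ x y : ℤ, (((principalForm Δ).eval x y : ℤ) : ZMod Δ.natAbs) = u ∧
      Odd ((principalForm Δ).eval x y) := by
  obtain ⟨x, y, hxy⟩ := mem_valSubgroup_iff.1 hu
  rcases Int.even_or_odd Δ with he | ho
  · refine ⟨x, y, hxy, Int.not_even_iff_odd.1 fun h => Int.prime_two.not_isUnit ?_⟩
    exact (isUnit_intCast_zmod_natAbs_iff.1 (hxy ▸ u.isUnit)).isUnit_of_dvd'
      (even_iff_two_dvd.1 h) (even_iff_two_dvd.1 he)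
  · have hcop : IsCoprime 2 Δ := Int.isCoprime_two_left.2 ho
    obtain ⟨x', hx', hx⟩ := exists_modEq_and_modEq hcop 1 x
    obtain ⟨y', hy', hy⟩ := exists_modEq_and_modEq hcop 0 y
    refine ⟨x', y', ?_, ?_⟩
    · rw [← hxy, intCast_zmod_natAbs_eq_iff]
      exact BinForm.eval_modEq _ hx hy
    · rw [Int.odd_iff]
      have hmod := BinForm.eval_modEq (principalForm Δ) hx' hy'
      rwa [show (principalForm Δ).eval 1 0 = 1 by simp [principalForm, BinForm.eval]] at hmod

section Character

variable {Δ : ℤ} [NegDisc Δ]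

theorem discChar_eq_jacobiSym {u : (ZMod Δ.natAbs)ˣ} {n : ℕ} (hn : Odd n)
    (h : (n : ZMod Δ.natAbs) = u) : (discChar Δ u : ℤ) = J(Δ | n) :=
  jacobiSym_congr (oddRep_odd u) hn (by rw [oddRep_cast, h])

/- With `D = |Δ|`, the class of `-1` contains `4 * D - 1`, modulo which `D` is the square of
`2 * D` while `-1` is a nonresidue. -/
theorem discChar_neg_one : discChar Δ (-1) = -1 := by
  have hneg := NegDisc.neg (Δ := Δ)
  obtain ⟨D, hD⟩ : ∃ D, D = Δ.natAbs := ⟨_, rfl⟩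
  have hodd : Odd (4 * D - 1) := Nat.odd_iff.2 (by omega)
  have hcast : ((4 * D - 1 : ℕ) : ℤ) = 4 * D - 1 := by omega
  have hrep : ((4 * D - 1 : ℕ) : ZMod Δ.natAbs) = ((-1 : (ZMod Δ.natAbs)ˣ) : ZMod Δ.natAbs) := by
    rw [Nat.cast_sub (by omega), hD]
    simp
  have hsq : J((D : ℤ) | 4 * D - 1) = 1 :=
    jacobiSym_eq_one_of_dvd_sq_sub (b := 2 * D) (by rw [hcast]; exact ⟨4, -1, by ring⟩)
      (by rw [hcast]; exact ⟨D, by ring⟩)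
  apply Units.ext
  rw [discChar_eq_jacobiSym hodd hrep, show Δ = -D by omega, jacobiSym.neg _ hodd, hsq, mul_one,
    ZMod.χ₄_nat_three_mod_four (by omega)]
  rfl

theorem discChar_neg (u : (ZMod Δ.natAbs)ˣ) : discChar Δ (-u) = -discChar Δ u := by
  rw [← neg_one_mul u, map_mul, discChar_neg_one, neg_one_mul]

theorem eval_principalForm_nonneg (x y : ℤ) : 0 ≤ (principalForm Δ).eval x y := by
  have hneg := NegDisc.neg (Δ := Δ)
  have hfour : 4 * (principalForm Δ).eval x y = (2 * x + parity Δ * y) ^ 2 + -Δ * y ^ 2 := by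
    simp only [principalForm, BinForm.eval]
    linear_combination (-y ^ 2) * four_mul_par (Δ := Δ)
  have hnonneg : 0 ≤ -Δ * y ^ 2 := mul_nonneg (by omega) (sq_nonneg y)
  linarith [sq_nonneg (2 * x + parity Δ * y)]

theorem valSubgroup_le_ker_discChar : valSubgroup Δ ≤ (discChar Δ).ker := by
  intro u hu
  obtain ⟨x, y, hxy, hodd⟩ := exists_odd_eval_principalForm hu
  have hcop := (isUnit_intCast_zmod_natAbs_iff.1 (hxy ▸ u.isUnit)).symm
  have hrep : (((principalForm Δ).eval x y).natAbs : ZMod Δ.natAbs) = u := by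
    rw [← hxy, ← Int.cast_natCast, Int.natAbs_of_nonneg (eval_principalForm_nonneg x y)]
  apply Units.ext
  rw [discChar_eq_jacobiSym (Int.natAbs_odd.2 hodd) hrep, Units.val_one]
  simpa only [disc_principalForm] using
    (principalForm Δ).jacobiSym_disc_natAbs_eval (by rwa [disc_principalForm])

theorem phi_injective : Function.Injective (phi Δ) := by
  rw [injective_iff_map_eq_one]
  rintro ⟨u, hu⟩ h
  rcases (QuotientGroup.eq_one_iff u).1 h with hval | hval
  · exact (QuotientGroup.eq_one_iff _).2 hval
  · have hneg : discChar Δ (-u) = 1 := valSubgroup_le_ker_discChar hval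
    rw [discChar_neg, MonoidHom.mem_ker.1 hu] at hneg
    exact absurd hneg (by decide)

theorem exists_discChar_eq_one (g : (ZMod Δ.natAbs)ˣ ⧸ pmValSubgroup Δ) :
    ∃ u : (ZMod Δ.natAbs)ˣ, discChar Δ u = 1 ∧ u = g := by
  obtain ⟨u, rfl⟩ := QuotientGroup.mk_surjective g
  rcases Int.units_eq_one_or (discChar Δ u) with h | h
  · exact ⟨u, h, rfl⟩
  · exact ⟨-u, by rw [discChar_neg, h, neg_neg], mk_neg_eq_mk u⟩

theorem phi_surjective : Function.Surjective (phi Δ) := by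
  intro g
  obtain ⟨u, hu, rfl⟩ := exists_discChar_eq_one g
  exact ⟨((⟨u, hu⟩ : (discChar Δ).ker) : _ ⧸ _), rfl⟩

end Character

/-! ### Values of a class -/

section Twist

variable {R : Type*} [CommRing R] {Δ : R}

/-- The twisted action of `GL₂(R)` on primitive forms of fixed discriminant, whose orbits are the
classes in `ClTw R Δ`. -/
def PrimForm.twist (q : PrimForm R Δ) (M : GL (Fin 2) R) : PrimForm R Δ :=
  ⟨q.1.twist M, q.2.1.twist M, (q.1.disc_twist M).trans q.2.2⟩

theorem ClTw.mk_twist (q : PrimForm R Δ) (M : GL (Fin 2) R) :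
    ClTw.mk (q.twist M) = ClTw.mk q :=
  (Quotient.sound (s := twSetoid R Δ) ⟨M, rfl⟩).symm

theorem ClTw.exists_twist_eq_of_mk_eq {q q' : PrimForm R Δ} (h : ClTw.mk q = ClTw.mk q') :
    ∃ M, q' = q.twist M := by
  obtain ⟨M, hM⟩ := Quotient.exact (s := twSetoid R Δ) h
  exact ⟨M, Subtype.ext hM⟩

theorem ClTw.exists_mk_eq_a_eq_eval (q : PrimForm R Δ) {x y : R} (h : IsCoprime x y) :
    ∃ q' : PrimForm R Δ, ClTw.mk q' = ClTw.mk q ∧ q'.1.a = q.1.eval x y := by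
  obtain ⟨g, hg⟩ := q.1.exists_twist_a_eq_eval h
  exact ⟨q.twist g, ClTw.mk_twist q g, hg⟩

theorem ClTw.exists_mk_eq_b_eq_add (q : PrimForm R Δ) (k : R) :
    ∃ q' : PrimForm R Δ, ClTw.mk q' = ClTw.mk q ∧ q'.1.a = q.1.a ∧
      q'.1.b = q.1.b + 2 * q.1.a * k := by
  let g : SL(2, R) := ⟨!![1, k; 0, 1], by simp⟩
  refine ⟨q.twist g, ClTw.mk_twist q g, (q.1.twist_coe_SL_a g).trans ?_,
    (q.1.twist_coe_SL_b g).trans ?_⟩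
  · simp [BinForm.eval, g]
  · simp [g, add_comm]

/-- The form `[a, b, c]`, which is primitive as soon as `a` is prime to its discriminant. -/
def PrimForm.ofIsCoprime (a b c : R) (h : b ^ 2 - 4 * a * c = Δ) (ha : IsCoprime a Δ) :
    PrimForm R Δ :=
  ⟨⟨a, b, c⟩, BinForm.isPrimitive_of_isCoprime (by rwa [← h] at ha), h⟩

end Twist

section ClassValues

variable {Δ : ℤ}

theorem mem_val_or_neg_mem_val_of_mem_val_twist {q : BinForm ℤ} {M : GL (Fin 2) ℤ}
    {v : (ZMod Δ.natAbs)ˣ} (h : v ∈ val Δ (q.twist M)) : v ∈ val Δ q ∨ -v ∈ val Δ q := by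
  obtain ⟨x, y, hxy⟩ := mem_val_iff.1 h
  rw [BinForm.eval_twist] at hxy
  rcases Int.units_eq_one_or (Matrix.GeneralLinearGroup.det M)⁻¹ with hd | hd
  · exact Or.inl (mem_val_iff.2 ⟨_, _, by rw [← hxy, hd, Units.val_one, one_mul]⟩)
  · rw [hd, Units.val_neg, Units.val_one, neg_one_mul, Int.cast_neg] at hxy
    exact Or.inr (mem_val_iff.2 ⟨_, _, by rw [Units.val_neg, ← hxy, neg_neg]⟩)

theorem exists_mem_val_twist_of_neg_mem_val {q : BinForm ℤ} {v : (ZMod Δ.natAbs)ˣ}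
    (h : -v ∈ val Δ q) : ∃ M : GL (Fin 2) ℤ, v ∈ val Δ (q.twist M) := by
  obtain ⟨x, y, hxy⟩ := mem_val_iff.1 h
  let M : GL (Fin 2) ℤ := Matrix.GeneralLinearGroup.mk'' !![1, 0; 0, -1] (by simp)
  have hdet : Matrix.GeneralLinearGroup.det M = -1 := Units.ext (by simp [M])
  refine ⟨M, mem_val_iff.2 ⟨x, -y, ?_⟩⟩
  rw [← neg_neg v, Units.val_neg, ← hxy, BinForm.eval_twist, hdet]
  simp [M]

theorem mem_classVal_mk_iff (q : PrimForm ℤ Δ) {v : (ZMod Δ.natAbs)ˣ} :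
    v ∈ classVal (ClTw.mk q) ↔ v ∈ val Δ q.1 ∨ -v ∈ val Δ q.1 := by
  constructor
  · rintro ⟨q', hq', hv⟩
    obtain ⟨M, rfl⟩ := ClTw.exists_twist_eq_of_mk_eq hq'.symm
    exact mem_val_or_neg_mem_val_of_mem_val_twist hv
  · rintro (h | h)
    · exact ⟨q, rfl, h⟩
    · obtain ⟨M, hM⟩ := exists_mem_val_twist_of_neg_mem_val h
      exact ⟨q.twist M, ClTw.mk_twist q M, hM⟩

theorem mk_eq_mk_iff_mul_mem (u v : (ZMod Δ.natAbs)ˣ) :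
    (v : (ZMod Δ.natAbs)ˣ ⧸ pmValSubgroup Δ) = u ↔ u * v ∈ pmValSubgroup Δ := by
  have h : v * v ∈ pmValSubgroup Δ := Or.inl (mul_self_mem_valSubgroup v)
  rw [QuotientGroup.eq, ← Subgroup.mul_mem_cancel_right _ h,
    show v⁻¹ * u * (v * v) = u * v by rw [mul_mul_mul_comm, inv_mul_cancel, one_mul]]

theorem ClTw.exists_isCoprime_a (C : ClTw ℤ Δ) {n : ℤ} (hn : n ≠ 0) :
    ∃ q : PrimForm ℤ Δ, ClTw.mk q = C ∧ IsCoprime q.1.a n := by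
  obtain ⟨q, rfl⟩ := Quotient.exists_rep C
  obtain ⟨x, y, hxy, h⟩ := BinForm.exists_isCoprime_isCoprime_eval q.2.1 hn
  obtain ⟨q', hq', ha⟩ := ClTw.exists_mk_eq_a_eq_eval q hxy
  exact ⟨q', hq', ha ▸ h⟩

variable [NegDisc Δ]

theorem PrimForm.a_mul_eval (q : PrimForm ℤ Δ) (x y : ℤ) :
    q.1.a * q.1.eval x y =
      (principalForm Δ).eval (q.1.a * x - (parity Δ - q.1.b) / 2 * y) y := by
  simp only [BinForm.eval, principalForm]
  linear_combination q.1.a * x * y * q.exists_shift + y ^ 2 * q.mul_coeff q.exists_shift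

theorem mem_val_iff_mul_mem_valSubgroup (q : PrimForm ℤ Δ) {u v : (ZMod Δ.natAbs)ˣ}
    (hu : (u : ZMod Δ.natAbs) = q.1.a) : v ∈ val Δ q.1 ↔ u * v ∈ valSubgroup Δ := by
  rw [mem_val_iff, mem_valSubgroup_iff]
  constructor
  · rintro ⟨x, y, h⟩
    exact ⟨_, y, by rw [← q.a_mul_eval, Int.cast_mul, h, ← hu, Units.val_mul]⟩
  · rintro ⟨x, y, h⟩
    obtain ⟨s, t, hst⟩ := isUnit_intCast_zmod_natAbs_iff.1 (hu ▸ u.isUnit)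
    let k := (parity Δ - q.1.b) / 2
    have hmod : q.1.a * (s * (x + k * y)) - k * y ≡ x [ZMOD Δ] :=
      Int.modEq_iff_dvd.2 ⟨t * (x + k * y), by linear_combination (-(x + k * y)) * hst⟩
    refine ⟨s * (x + k * y), y, u.isUnit.mul_left_cancel ?_⟩
    rw [← Units.val_mul, ← h, hu, ← Int.cast_mul, q.a_mul_eval, intCast_zmod_natAbs_eq_iff]
    exact BinForm.eval_modEq _ hmod rfl

theorem mem_classVal_mk_iff_mk_eq (q : PrimForm ℤ Δ) {u v : (ZMod Δ.natAbs)ˣ}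
    (hu : (u : ZMod Δ.natAbs) = q.1.a) : v ∈ classVal (ClTw.mk q) ↔
      (v : (ZMod Δ.natAbs)ˣ ⧸ pmValSubgroup Δ) = u := by
  rw [mk_eq_mk_iff_mul_mem, mem_classVal_mk_iff, mem_val_iff_mul_mem_valSubgroup q hu,
    mem_val_iff_mul_mem_valSubgroup q hu, mul_neg]
  rfl

end ClassValues

/-! ### Composition -/

theorem span_pair_mul_span_pair_of_sq_eq {R : Type*} [CommRing R] {θ a₁ a₂ b c r s t : R}
    (hθ : θ ^ 2 + b * θ + a₁ * a₂ * c = 0) (h : r * a₁ + s * a₂ + t * b = 1) :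
    Ideal.span {θ, a₁} * Ideal.span {θ, a₂} = Ideal.span {θ, a₁ * a₂} := by
  rw [Ideal.span_pair_mul_span_pair]
  apply le_antisymm <;> rw [Ideal.span_le]
  · have hmem : θ ∈ Ideal.span {θ, a₁ * a₂} := Ideal.mem_span_pair.2 ⟨1, 0, by ring⟩
    rintro _ (rfl | rfl | rfl | rfl)
    · exact Ideal.mul_mem_left _ _ hmem
    · exact Ideal.mul_mem_right _ _ hmem
    · exact Ideal.mul_mem_left _ _ hmem
    · exact Ideal.mem_span_pair.2 ⟨0, 1, by ring⟩
  · set I := Ideal.span {θ * θ, θ * a₂, a₁ * θ, a₁ * a₂}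
    have hsum : θ = -t * (θ * θ) + s * (θ * a₂) + r * (a₁ * θ) + -(t * c) * (a₁ * a₂) := by
      linear_combination (-θ) * h + t * hθ
    have hmul : a₁ * a₂ ∈ I := Ideal.subset_span (by simp)
    have hmem : θ ∈ I := by
      rw [hsum]
      refine add_mem (add_mem (add_mem ?_ ?_) ?_) (Ideal.mul_mem_left _ _ hmul) <;>
        exact Ideal.mul_mem_left _ _ (Ideal.subset_span (by simp))
    exact Set.insert_subset hmem (Set.singleton_subset_iff.2 hmul)

section Composition

variable {Δ : ℤ} [NegDisc Δ]

theorem PrimForm.sq_add_b_mul_add_a_mul_c (q : PrimForm ℤ Δ) :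
    (QuadraticAlgebra.omega + (((parity Δ - q.1.b) / 2 : ℤ) : QuadOrder Δ)) ^ 2 +
      (q.1.b : QuadOrder Δ) *
        (QuadraticAlgebra.omega + (((parity Δ - q.1.b) / 2 : ℤ) : QuadOrder Δ)) +
      (q.1.a : QuadOrder Δ) * (q.1.c : QuadOrder Δ) = 0 := by
  have hb := q.exists_shift
  have hac := q.mul_coeff hb
  rw [sq (_ + _)]
  set k := (parity Δ - q.1.b) / 2
  ext
  · simp only [QuadraticAlgebra.re_add, QuadraticAlgebra.re_mul, QuadraticAlgebra.omega_re,
      QuadraticAlgebra.re_intCast, Int.cast_eq, zero_add, QuadraticAlgebra.im_add,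
      QuadraticAlgebra.omega_im, QuadraticAlgebra.im_intCast, add_zero, mul_one, mul_zero,
      QuadraticAlgebra.re_zero]
    linear_combination hac + k * hb
  · simp only [QuadraticAlgebra.im_add, QuadraticAlgebra.im_mul, QuadraticAlgebra.re_add,
      QuadraticAlgebra.omega_re, QuadraticAlgebra.re_intCast, Int.cast_eq, zero_add,
      QuadraticAlgebra.omega_im, QuadraticAlgebra.im_intCast, add_zero, mul_one, one_mul,
      zero_mul, mul_zero, QuadraticAlgebra.im_zero]
    linear_combination hb

theorem ClTw.mk_mul_mk_of_formIdeal_mul_eq {q₁ q₂ q₃ : PrimForm ℤ Δ}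
    (h : formIdeal q₁ * formIdeal q₂ = formIdeal q₃) :
    ClTw.mk q₁ * ClTw.mk q₂ = ClTw.mk q₃ := by
  have hclass : formClass q₁ * formClass q₂ = formClass q₃ := by
    rw [formClass, formClass, formClass, ← map_mul]
    congr 1
    apply Units.ext
    rw [Units.val_mul, IsUnit.unit_spec, IsUnit.unit_spec, IsUnit.unit_spec,
      ← FractionalIdeal.coeIdeal_mul, h]
  exact ClTw.equivClassGroup.symm_apply_eq.2 hclass

theorem ClTw.mk_mul_mk_of_b_eq {q₁ q₂ q₃ : PrimForm ℤ Δ} (hb₁ : q₁.1.b = q₃.1.b)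
    (hb₂ : q₂.1.b = q₃.1.b) (ha : q₃.1.a = q₁.1.a * q₂.1.a) {r s t : ℤ}
    (h : r * q₁.1.a + s * q₂.1.a + t * q₃.1.b = 1) :
    ClTw.mk q₁ * ClTw.mk q₂ = ClTw.mk q₃ := by
  apply ClTw.mk_mul_mk_of_formIdeal_mul_eq
  have hθ := q₃.sq_add_b_mul_add_a_mul_c
  rw [ha, Int.cast_mul] at hθ
  rw [formIdeal, formIdeal, formIdeal, hb₁, hb₂, ha, Int.cast_mul]
  exact span_pair_mul_span_pair_of_sq_eq (r := (r : QuadOrder Δ)) (s := s) (t := t) hθ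
    (by exact_mod_cast congrArg (Int.cast : ℤ → QuadOrder Δ) h)

theorem ClTw.exists_mk_eq_mk_eq_b_eq (q₁ q₂ : PrimForm ℤ Δ) (h : IsCoprime q₁.1.a q₂.1.a) :
    ∃ q₁' q₂' : PrimForm ℤ Δ, ClTw.mk q₁' = ClTw.mk q₁ ∧ ClTw.mk q₂' = ClTw.mk q₂ ∧
      q₁'.1.a = q₁.1.a ∧ q₂'.1.a = q₂.1.a ∧ q₁'.1.b = q₂'.1.b := by
  obtain ⟨s, t, hst⟩ := h
  set d := (parity Δ - q₁.1.b) / 2 - (parity Δ - q₂.1.b) / 2 with hd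
  obtain ⟨q₁', hq₁, ha₁, hb₁⟩ := ClTw.exists_mk_eq_b_eq_add q₁ (d * s)
  obtain ⟨q₂', hq₂, ha₂, hb₂⟩ := ClTw.exists_mk_eq_b_eq_add q₂ (-d * t)
  refine ⟨q₁', q₂', hq₁, hq₂, ha₁, ha₂, ?_⟩
  rw [hb₁, hb₂]
  linear_combination 2 * d * hst + q₁.exists_shift - q₂.exists_shift + 2 * hd

theorem ClTw.exists_mk_mul_mk (C₁ C₂ : ClTw ℤ Δ) : ∃ q₁ q₂ q₃ : PrimForm ℤ Δ,
    ClTw.mk q₁ = C₁ ∧ ClTw.mk q₂ = C₂ ∧ ClTw.mk q₃ = C₁ * C₂ ∧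
      q₃.1.a = q₁.1.a * q₂.1.a ∧ IsCoprime q₃.1.a Δ := by
  obtain ⟨p₁, rfl, hc₁⟩ := C₁.exists_isCoprime_a (NegDisc.neg (Δ := Δ)).ne
  obtain ⟨p₂, rfl, hc₂⟩ := C₂.exists_isCoprime_a
    (mul_ne_zero (NegDisc.neg (Δ := Δ)).ne p₁.a_ne_zero)
  obtain ⟨q₁, q₂, hq₁, hq₂, ha₁, ha₂, hb⟩ :=
    ClTw.exists_mk_eq_mk_eq_b_eq p₁ p₂ hc₂.of_mul_right_right.symm
  rw [← hq₁, ← hq₂]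
  rw [← ha₁] at hc₁ hc₂
  rw [← ha₂] at hc₂
  have hd₁ : q₁.1.b ^ 2 - 4 * q₁.1.a * q₁.1.c = Δ := q₁.2.2
  have hd₂ : q₂.1.b ^ 2 - 4 * q₂.1.a * q₂.1.c = Δ := q₂.2.2
  have hac : q₁.1.a * q₁.1.c = q₂.1.a * q₂.1.c := by
    rw [← hb] at hd₂
    linarith
  obtain ⟨c, hc⟩ := hc₂.of_mul_right_right.dvd_of_dvd_mul_left ⟨_, hac⟩
  have hdisc : q₁.1.b ^ 2 - 4 * (q₁.1.a * q₂.1.a) * c = Δ := by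
    linear_combination hd₁ + 4 * q₁.1.a * hc
  have hcop : IsCoprime (q₁.1.a * q₂.1.a) Δ := hc₁.mul_left hc₂.of_mul_right_left
  obtain ⟨r, s, hrs⟩ := hc₂.of_mul_right_right
  let q₃ := PrimForm.ofIsCoprime _ _ c hdisc hcop
  refine ⟨q₁, q₂, q₃, rfl, rfl, ?_, rfl, hcop⟩
  exact (ClTw.mk_mul_mk_of_b_eq (q₁ := q₁) (q₂ := q₂) (q₃ := q₃) (r := s) (s := r) (t := 0)
    rfl hb.symm rfl (by linear_combination hrs)).symm

theorem ClTw.isSquare_mk_of_a_eq_sq (q : PrimForm ℤ Δ) {m : ℤ} (hm : IsCoprime m Δ)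
    (h : q.1.a = m ^ 2) : IsSquare (ClTw.mk q) := by
  have hd : q.1.b ^ 2 - 4 * q.1.a * q.1.c = Δ := q.2.2
  rw [h] at hd
  have hdvd : Δ ≡ q.1.b ^ 2 [ZMOD m] :=
    Int.modEq_iff_dvd.2 ⟨4 * m * q.1.c, by linear_combination hd⟩
  obtain ⟨t, r, hrt⟩ := (IsCoprime.pow_left_iff two_pos).1 (isCoprime_of_modEq hdvd hm.symm)
  let q' : PrimForm ℤ Δ :=
    PrimForm.ofIsCoprime m q.1.b (m * q.1.c) (by linear_combination hd) hm
  refine ⟨ClTw.mk q', (ClTw.mk_mul_mk_of_b_eq (q₁ := q') (q₂ := q') (q₃ := q) rfl rfl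
    (h.trans (sq m)) (r := r) (s := 0) (t := t) ?_).symm⟩
  change r * m + 0 * m + t * q.1.b = 1
  linear_combination hrt

theorem ClTw.isSquare_of_one_mem_classVal {C : ClTw ℤ Δ} (h : 1 ∈ classVal C) : IsSquare C := by
  obtain ⟨q, rfl, hval⟩ := h
  obtain ⟨x, y, hxy⟩ := mem_val_iff.1 hval
  rw [Units.val_one, ← Int.cast_one, intCast_zmod_natAbs_eq_iff] at hxy
  have hdvd : q.1.disc ∣ q.1.eval x y - 1 := by
    rw [q.2.2]
    exact hxy.symm.dvd
  have hdisc : q.1.disc ≠ 0 := by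
    rw [q.2.2]
    exact (NegDisc.neg (Δ := Δ)).ne
  obtain ⟨x, y, m, hcop, hm, hsq⟩ := BinForm.exists_eval_eq_sq hdisc hdvd
  obtain ⟨q', hq', ha⟩ := ClTw.exists_mk_eq_a_eq_eval q hcop
  rw [← hq']
  exact ClTw.isSquare_mk_of_a_eq_sq q' (q.2.2 ▸ hm) (ha.trans hsq)

end Composition

/-! ### The genus homomorphism -/

section Genus

variable {Δ : ℤ} [NegDisc Δ]

theorem four_dvd_sq_sub_of_modEq_parity {b : ℤ} (h : b ≡ parity Δ [ZMOD 2]) : 4 ∣ b ^ 2 - Δ := by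
  obtain ⟨j, hj⟩ := h.dvd
  exact ⟨j ^ 2 - j * parity Δ - (Δ - parity Δ ^ 2) / 4, by
    linear_combination four_mul_par (Δ := Δ) - (b + parity Δ - 2 * j) * hj⟩

theorem exists_four_mul_dvd_sq_sub {n b : ℤ} (hn : Odd n) (h : n ∣ b ^ 2 - Δ) :
    ∃ b', 4 * n ∣ b' ^ 2 - Δ := by
  have hn₂ : IsCoprime 2 n := Int.isCoprime_two_left.2 hn
  obtain ⟨b', hpar, hb'⟩ := exists_modEq_and_modEq hn₂ (parity Δ) b
  have hsq : b' ^ 2 - Δ ≡ b ^ 2 - Δ [ZMOD n] := (hb'.pow 2).sub_right Δ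
  have hn₄ : IsCoprime 4 n := hn₂.pow_left (m := 2)
  exact ⟨b', hn₄.mul_dvd (four_dvd_sq_sub_of_modEq_parity hpar) (hsq.dvd_iff.2 h)⟩

theorem exists_dvd_sq_sub_of_legendreSym_eq_one {p : ℕ} [Fact p.Prime] {a : ℤ}
    (h : legendreSym p a = 1) : ∃ b : ℤ, (p : ℤ) ∣ b ^ 2 - a := by
  have ha : (a : ZMod p) ≠ 0 := fun h₀ => by simp [(legendreSym.eq_zero_iff p a).2 h₀] at h
  obtain ⟨r, hr⟩ := (legendreSym.eq_one_iff p ha).1 h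
  obtain ⟨b, rfl⟩ := ZMod.intCast_surjective r
  refine ⟨b, (ZMod.intCast_zmod_eq_zero_iff_dvd _ p).1 ?_⟩
  rw [Int.cast_sub, Int.cast_pow, hr, sq, sub_self]

theorem exists_primForm_of_discChar_eq_one {u : (ZMod Δ.natAbs)ˣ} (hu : discChar Δ u = 1) :
    ∃ q : PrimForm ℤ Δ, (u : ZMod Δ.natAbs) = q.1.a := by
  obtain ⟨p, hp₂, hp, hpu⟩ := Nat.forall_exists_prime_gt_and_eq_mod u.isUnit 2
  have : Fact p.Prime := ⟨hp⟩
  have hodd : Odd p := hp.odd_of_ne_two hp₂.ne'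
  have hcop : IsCoprime (p : ℤ) Δ := by
    rw [← isUnit_intCast_zmod_natAbs_iff, Int.cast_natCast, hpu]
    exact u.isUnit
  have hsym : legendreSym p Δ = 1 := by
    rw [jacobiSym.legendreSym.to_jacobiSym, ← discChar_eq_jacobiSym hodd hpu, hu, Units.val_one]
  obtain ⟨b, hb⟩ := exists_dvd_sq_sub_of_legendreSym_eq_one hsym
  obtain ⟨b', c, hc⟩ := exists_four_mul_dvd_sq_sub (by exact_mod_cast hodd) hb
  exact ⟨PrimForm.ofIsCoprime p b' c (by linear_combination hc) hcop,
    hpu.symm.trans (Int.cast_natCast p).symm⟩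

theorem exists_coset_eq_classVal (C : ClTw ℤ Δ) : ∃ g : (ZMod Δ.natAbs)ˣ ⧸ pmValSubgroup Δ,
    {u : (ZMod Δ.natAbs)ˣ | (u : (ZMod Δ.natAbs)ˣ ⧸ pmValSubgroup Δ) = g} = classVal C := by
  obtain ⟨q, rfl, hq⟩ := C.exists_isCoprime_a (NegDisc.neg (Δ := Δ)).ne
  obtain ⟨u, hu⟩ := isUnit_intCast_zmod_natAbs_iff.2 hq
  exact ⟨u, Set.ext fun v => (mem_classVal_mk_iff_mk_eq q hu).symm⟩

/-- The coset `H_C` of `± Val_Δ(q₀)` attached to a class `C`, as an element of the quotient. -/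
noncomputable def genus (C : ClTw ℤ Δ) : (ZMod Δ.natAbs)ˣ ⧸ pmValSubgroup Δ :=
  (exists_coset_eq_classVal C).choose

theorem mem_classVal_iff_mk_eq_genus {C : ClTw ℤ Δ} {u : (ZMod Δ.natAbs)ˣ} :
    u ∈ classVal C ↔ (u : (ZMod Δ.natAbs)ˣ ⧸ pmValSubgroup Δ) = genus C :=
  (Set.ext_iff.1 (exists_coset_eq_classVal C).choose_spec u).symm

theorem genus_mk (q : PrimForm ℤ Δ) {u : (ZMod Δ.natAbs)ˣ} (hu : (u : ZMod Δ.natAbs) = q.1.a) :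
    genus (ClTw.mk q) = u :=
  (mem_classVal_iff_mk_eq_genus.1 ((mem_classVal_mk_iff_mk_eq q hu).2 rfl)).symm

theorem genus_mul (C₁ C₂ : ClTw ℤ Δ) : genus (C₁ * C₂) = genus C₁ * genus C₂ := by
  obtain ⟨q₁, q₂, q₃, rfl, rfl, hq₃, ha, hcop⟩ := ClTw.exists_mk_mul_mk C₁ C₂
  rw [ha] at hcop
  obtain ⟨u₁, hu₁⟩ := isUnit_intCast_zmod_natAbs_iff.2 hcop.of_mul_left_left
  obtain ⟨u₂, hu₂⟩ := isUnit_intCast_zmod_natAbs_iff.2 hcop.of_mul_left_right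
  have hu₃ : ((u₁ * u₂ : (ZMod Δ.natAbs)ˣ) : ZMod Δ.natAbs) = q₃.1.a := by
    rw [ha, Units.val_mul, hu₁, hu₂, Int.cast_mul]
  rw [← hq₃, genus_mk q₁ hu₁, genus_mk q₂ hu₂, genus_mk q₃ hu₃, QuotientGroup.mk_mul]

variable (Δ) in
/-- The homomorphism `ψ` sending a class `C` to the coset `H_C`. -/
noncomputable def genusHom : ClTw ℤ Δ →* (ZMod Δ.natAbs)ˣ ⧸ pmValSubgroup Δ :=
  MonoidHom.mk' genus genus_mul

theorem isGenusHom_genusHom : IsGenusHom (genusHom Δ) := fun _ =>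
  Set.ext fun _ => mem_classVal_iff_mk_eq_genus.symm

theorem ker_genusHom : (genusHom Δ).ker = Subgroup.square (ClTw ℤ Δ) := by
  ext C
  rw [MonoidHom.mem_ker, Subgroup.mem_square]
  constructor
  · intro h
    exact ClTw.isSquare_of_one_mem_classVal (mem_classVal_iff_mk_eq_genus.2 h.symm)
  · rintro ⟨D, rfl⟩
    rw [map_mul, mul_self_eq_one_of_quotient_pmValSubgroup]

theorem genusHom_surjective : Function.Surjective (genusHom Δ) := by
  intro g
  obtain ⟨u, hu, rfl⟩ := exists_discChar_eq_one g
  obtain ⟨q, hq⟩ := exists_primForm_of_discChar_eq_one hu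
  exact ⟨ClTw.mk q, genus_mk q hq⟩

end Genus

end GenusTheory

open GenusTheory
theorem mainTheorem8 (Δ : ℤ) [NegDisc Δ] :
    valSubgroup Δ ≤ (discChar Δ).ker ∧
    Function.Bijective (phi Δ) ∧
    ∃ ψ : ClTw ℤ Δ →* (ZMod Δ.natAbs)ˣ ⧸ pmValSubgroup Δ,
      IsGenusHom ψ ∧
      ψ.ker = Subgroup.square (ClTw ℤ Δ) ∧
      ∃ Ψ : ClTw ℤ Δ ⧸ Subgroup.square (ClTw ℤ Δ) ≃* (ZMod Δ.natAbs)ˣ ⧸ pmValSubgroup Δ,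
        ∀ C : ClTw ℤ Δ, Ψ (C : ClTw ℤ Δ ⧸ Subgroup.square (ClTw ℤ Δ)) = ψ C :=
  ⟨valSubgroup_le_ker_discChar, ⟨phi_injective, phi_surjective⟩, genusHom Δ,
    isGenusHom_genusHom, ker_genusHom,
    (QuotientGroup.quotientMulEquivOfEq ker_genusHom.symm).trans
      (QuotientGroup.quotientKerEquivOfSurjective _ genusHom_surjective),
    fun _ => rfl⟩
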